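/- Let $A$ and $B$ be complex vector spaces of finite dimensions $a,b\ge 1$, and let $Fl(\cdot)$ denote the variety of complete flags. For a standard tableau $T$ of rectangular shape $a\times b$ (a bijective numbering of the boxes $(i,j)$, $1\le i\le a$, $1\le j\le b$, by $1,\dots,ab$, increasing along rows and columns), let $\iota_T: Fl(A)\times Fl(B)\to Fl(A\otimes B)$ be the map $(A_\bullet,B_\bullet)\mapsto C_\bullet$, where $C_k=\langle u_i\otimes v_j \mid T(i,j)\le k\rangle$ for any bases $u_1,\dots,u_a$ of $A$ and $v_1,\dots,v_b$ of $B$ adapted to the flags, i.e. $A_i=\langle u_1,\dots,u_i\rangle$ and $B_j=\langle v_1,\dots,v_j\rangle$. (1) Each $\iota_T$ is a $GL(A)\times GL(B)$-equivariant embedding, and every $GL(A)\times GL(B)$-equivariant embedding $Fl(A)\times Fl(B)\hookrightarrow Fl(A\otimes B)$ is equal to $\iota_T$ for a unique standard tableau $T$ of shape $a\times b$. (2) Let $N$ be the normal bundle of $\iota_T$. Let $P$ be the stabilizer in $GL(A)\times GL(B)$ of a point $y$ of $Fl(A)\times Fl(B)$, and let $L$ be a Levi factor of $P$ (a maximal torus).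 Let $gr(N^*)$ be the $P$-module associated graded to the conormal $P$-module $N_y^*$, for its canonical filtration whose graded pieces have trivial action of the unipotent radical of $P$. The embedding $\iota_T$ is called stabilizing if the highest weights of the positive degree part of the symmetric algebra $S^*(gr(N^*))$, considered as an $L$-module, are contained in some open half space of the weight lattice of $L$. Then $\iota_T$ is stabilizing if and only if $T$ is additive, i.e. there are real numbers $x_1<\cdots<x_a$ and $y_1<\cdots<y_b$ such that for all $i,j,k,l$ $$T(i,j)<T(k,l)\iff x_i+y_j<x_k+y_l.$$ -/

import Mathlib

open scoped TensorProduct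

noncomputable section

/-! ### Complete flags -/

/-- A complete flag `0 = V₀ ⊂ V₁ ⊂ ⋯ ⊂ Vₙ = V` of subspaces, `dim Vᵢ = i`, of a complex vector
space `V` (of dimension `n`). The type `CompleteFlag n V` is the complete flag variety `Fl(V)`. -/
@[ext]
structure CompleteFlag (n : ℕ) (V : Type*) [AddCommGroup V] [Module ℂ V] where
  space : Fin (n + 1) → Submodule ℂ V
  mono : Monotone space
  finrank_space : ∀ i, Module.finrank ℂ (space i) = i
  space_zero : space 0 = ⊥
  space_last : space (Fin.last n) = ⊤

namespace CompleteFlag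

variable {n : ℕ} {V : Type*} [AddCommGroup V] [Module ℂ V]

/-- `GL(V)` acts on the complete flags of `V`. -/
instance : MulAction (V ≃ₗ[ℂ] V) (CompleteFlag n V) where
  smul g F :=
    { space := fun i => (F.space i).map (g : V →ₗ[ℂ] V)
      mono := fun _ _ h => Submodule.map_mono (F.mono h)
      finrank_space := fun i => by
        rw [LinearEquiv.finrank_map_eq]
        exact F.finrank_space i
      space_zero := by
        rw [F.space_zero, Submodule.map_bot]
      space_last := by
        rw [F.space_last, Submodule.map_top]
        exact LinearEquiv.range g }
  one_smul F := by
    ext i x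
    change x ∈ (F.space i).map (LinearMap.id : V →ₗ[ℂ] V) ↔ _
    rw [Submodule.map_id]
  mul_smul g h F := by
    ext i x
    change x ∈ (F.space i).map ((g : V →ₗ[ℂ] V) ∘ₗ (h : V →ₗ[ℂ] V)) ↔ _
    rw [Submodule.map_comp]
    rfl

theorem smul_space (g : V ≃ₗ[ℂ] V) (F : CompleteFlag n V) (i : Fin (n + 1)) :
    (g • F).space i = (F.space i).map (g : V →ₗ[ℂ] V) := rfl

theorem finiteDimensional_space (F : CompleteFlag n V) (i : Fin (n + 1)) (hi : 0 < (i : ℕ)) :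
    FiniteDimensional ℂ (F.space i) :=
  Module.finite_of_finrank_pos (by rw [F.finrank_space]; exact hi)

/-- A basis `u₁, …, uₙ` is adapted to the flag `V_•` if `Vᵢ = ⟨u₁, …, uᵢ⟩` for all `i`. -/
def IsAdapted (F : CompleteFlag n V) (u : Module.Basis (Fin n) ℂ V) : Prop :=
  ∀ i, F.space i = u.flag i

theorem finrank_basis_flag (u : Module.Basis (Fin n) ℂ V) (k : Fin (n + 1)) :
    Module.finrank ℂ (u.flag k) = k := by
  have h : u.flag k = Submodule.span ℂ (Set.range fun j : Fin (k : ℕ) =>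
      u (Fin.castLE (Nat.lt_succ_iff.mp k.2) j)) := by
    rw [Module.Basis.flag]
    congr 1
    ext x
    constructor
    · rintro ⟨i, hi, rfl⟩
      exact ⟨⟨i, hi⟩, rfl⟩
    · rintro ⟨j, rfl⟩
      exact ⟨_, j.2, rfl⟩
  have hl := u.linearIndependent.comp _ (Fin.castLE_injective (Nat.lt_succ_iff.mp k.2))
  have := finrank_span_eq_card hl
  rw [h]
  exact this.trans (by simp)

/-- The complete flag spanned by a basis. -/
def ofBasis (u : Module.Basis (Fin n) ℂ V) : CompleteFlag n V where
  space := u.flag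
  mono := u.flag_mono
  finrank_space := finrank_basis_flag u
  space_zero := u.flag_zero
  space_last := u.flag_last

theorem exists_isAdapted (F : CompleteFlag n V) :
    ∃ u : Module.Basis (Fin n) ℂ V, F.IsAdapted u := by
  have step : ∀ i : Fin n, ∃ x ∈ F.space i.succ, x ∉ F.space i.castSucc := by
    intro i
    by_contra! h
    have : FiniteDimensional ℂ (F.space i.castSucc) := by
      have := F.finiteDimensional_space i.succ (by simp)
      exact Submodule.finiteDimensional_of_le (F.mono (Fin.castSucc_le_succ i))
    have h1 : F.space i.succ ≤ F.space i.castSucc := h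
    have h2 := Submodule.finrank_mono h1
    rw [F.finrank_space, F.finrank_space] at h2
    simp at h2
  choose w hw hw' using step
  have hli : LinearIndependent ℂ w := by
    rw [Fintype.linearIndependent_iff]
    intro c hc
    by_contra! hne
    have hS : (Finset.univ.filter fun i => c i ≠ 0).Nonempty := by
      obtain ⟨i, hi⟩ := hne
      exact ⟨i, by simpa using hi⟩
    set m := (Finset.univ.filter fun i => c i ≠ 0).max' hS with hm
    have hmem : c m ≠ 0 := by
      have := Finset.max'_mem _ hS
      rw [← hm] at this
      simpa using this
    apply hw' m
    have h1 : c m • w m = -∑ i ∈ Finset.univ.erase m, c i • w i := by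
      rw [← Finset.add_sum_erase _ _ (Finset.mem_univ m)] at hc
      exact eq_neg_of_add_eq_zero_left hc
    have h2 : c m • w m ∈ F.space m.castSucc := by
      rw [h1]
      refine Submodule.neg_mem _ (Submodule.sum_mem _ fun i hi => ?_)
      by_cases hci : c i = 0
      · simp [hci]
      · have hle : i ≤ m := by
          rw [hm]
          exact Finset.le_max' _ _ (by simpa using hci)
        have hlt : i < m := lt_of_le_of_ne hle (Finset.ne_of_mem_erase hi)
        exact Submodule.smul_mem _ _ (F.mono (Fin.succ_le_castSucc_iff.mpr hlt) (hw i))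
    exact (Submodule.smul_mem_iff _ hmem).mp h2
  have hfr : Module.finrank ℂ V = n := by
    have h := F.finrank_space (Fin.last n)
    rw [F.space_last, finrank_top] at h
    simpa using h
  have hfin : FiniteDimensional ℂ V := by
    rcases Nat.eq_zero_or_pos n with hn | hn
    · subst hn
      have h : (⊥ : Submodule ℂ V) = ⊤ := F.space_zero.symm.trans F.space_last
      have := subsingleton_of_bot_eq_top h
      have : Subsingleton V := (Submodule.subsingleton_iff ℂ).mp this
      infer_instance
    · exact Module.finite_of_finrank_pos (by omega)
  let u : Module.Basis (Fin n) ℂ V := Module.Basis.mk hli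
    (hli.span_eq_top_of_card_eq_finrank' (by simp [hfr])).ge
  have hu : ∀ i, u i = w i := fun i => by simp [u]
  refine ⟨u, fun i => ?_⟩
  refine (Submodule.eq_of_le_of_finrank_eq ?_ ?_).symm
  · rw [Module.Basis.flag_le_iff]
    intro j hj
    rw [hu]
    exact F.mono (Fin.castSucc_lt_iff_succ_le.mp hj) (hw j)
  · rw [finrank_basis_flag, F.finrank_space]

end CompleteFlag

/-! ### Standard tableaux of rectangular shape -/

/-- A standard tableau of rectangular shape `a × b`: the boxes `(i, j)`, `1 ≤ i ≤ a`, `1 ≤ j ≤ b`,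
are numbered bijectively by `1, …, ab`, increasingly along the rows and down the columns.
(All the indices and entries are shifted to start from `0`.) -/
@[ext]
structure RectTableau (a b : ℕ) where
  entry : Fin a × Fin b ≃ Fin (a * b)
  row_strict : ∀ i, StrictMono fun j => entry (i, j)
  col_strict : ∀ j, StrictMono fun i => entry (i, j)

namespace RectTableau

variable {a b : ℕ}

/-- `T` is additive if there are increasing sequences `x₁ < ⋯ < x_a` and `y₁ < ⋯ < y_b` of real
numbers with `T(i,j) < T(k,l) ↔ x_i + y_j < x_k + y_l`. -/
def IsAdditive (T : RectTableau a b) : Prop :=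
  ∃ (x : Fin a → ℝ) (y : Fin b → ℝ), StrictMono x ∧ StrictMono y ∧
    ∀ i j k l, T.entry (i, j) < T.entry (k, l) ↔ x i + y j < x k + y l

theorem entry_le (T : RectTableau a b) {i i' : Fin a} {j j' : Fin b} (hi : i ≤ i') (hj : j ≤ j') :
    T.entry (i, j) ≤ T.entry (i', j') :=
  ((T.row_strict i).monotone hj).trans ((T.col_strict j').monotone hi)

end RectTableau

/-! ### Equivariant maps between flag varieties -/

/-- A `GL(A) × GL(B)`-equivariant map `Fl(A) × Fl(B) → Fl(A ⊗ B)`. The source being the homogeneous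
space `(GL(A) × GL(B)) / P`, such a map is an orbit map, thus automatically a morphism. -/
@[ext]
structure EquivariantFlagMap (a b : ℕ) (A B : Type*) [AddCommGroup A] [Module ℂ A]
    [AddCommGroup B] [Module ℂ B] where
  toFun : CompleteFlag a A × CompleteFlag b B → CompleteFlag (a * b) (A ⊗[ℂ] B)
  map_smul : ∀ (g : A ≃ₗ[ℂ] A) (h : B ≃ₗ[ℂ] B) (F : CompleteFlag a A) (F' : CompleteFlag b B),
    toFun (g • F, h • F') = TensorProduct.congr g h • toFun (F, F')

namespace RectTableau

variable {a b : ℕ} {A B : Type*} [AddCommGroup A] [Module ℂ A] [AddCommGroup B] [Module ℂ B]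

/-- The subspace `C_k = ∑_{T(i,j) ≤ k} A_i ⊗ B_j` of `A ⊗ B`. -/
def iotaSpace (T : RectTableau a b) (F : CompleteFlag a A) (F' : CompleteFlag b B)
    (k : Fin (a * b + 1)) : Submodule ℂ (A ⊗[ℂ] B) :=
  Submodule.span ℂ {z | ∃ i j, (T.entry (i, j)).castSucc < k ∧
    ∃ x ∈ F.space i.succ, ∃ y ∈ F'.space j.succ, z = x ⊗ₜ[ℂ] y}

/-- For all adapted bases `u`, `v`, one has `C_k = ⟨u_i ⊗ v_j, T(i,j) ≤ k⟩`. -/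
theorem iotaSpace_eq_span (T : RectTableau a b) {F : CompleteFlag a A} {F' : CompleteFlag b B}
    {u : Module.Basis (Fin a) ℂ A} {v : Module.Basis (Fin b) ℂ B}
    (hu : F.IsAdapted u) (hv : F'.IsAdapted v) (k : Fin (a * b + 1)) :
    T.iotaSpace F F' k = Submodule.span ℂ
      {z | ∃ i j, (T.entry (i, j)).castSucc < k ∧ z = u i ⊗ₜ[ℂ] v j} := by
  apply le_antisymm
  · refine Submodule.span_le.mpr ?_
    rintro _ ⟨i, j, hk, x, hx, y, hy, rfl⟩
    rw [hu] at hx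
    rw [hv] at hy
    rw [SetLike.mem_coe]
    induction hx using Submodule.span_induction with
    | zero => simp
    | add x x' _ _ h h' => rw [TensorProduct.add_tmul]; exact Submodule.add_mem _ h h'
    | smul c x _ h => rw [← TensorProduct.smul_tmul']; exact Submodule.smul_mem _ _ h
    | mem x hx =>
      obtain ⟨i', hi', rfl⟩ := hx
      induction hy using Submodule.span_induction with
      | zero => simp
      | add x x' _ _ h h' => rw [TensorProduct.tmul_add]; exact Submodule.add_mem _ h h'
      | smul c x _ h => rw [TensorProduct.tmul_smul]; exact Submodule.smul_mem _ _ h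
      | mem y hy =>
        obtain ⟨j', hj', rfl⟩ := hy
        refine Submodule.subset_span ⟨i', j', lt_of_le_of_lt ?_ hk, rfl⟩
        exact Fin.castSucc_le_castSucc_iff.mpr
          (T.entry_le (Fin.castSucc_lt_succ_iff.mp hi') (Fin.castSucc_lt_succ_iff.mp hj'))
  · refine Submodule.span_le.mpr ?_
    rintro _ ⟨i, j, hk, rfl⟩
    refine Submodule.subset_span ⟨i, j, hk, u i, ?_, v j, ?_, rfl⟩
    · rw [hu]
      exact u.self_mem_flag Fin.castSucc_lt_succ
    · rw [hv]
      exact v.self_mem_flag Fin.castSucc_lt_succ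

theorem iotaSpace_eq_flag (T : RectTableau a b) {F : CompleteFlag a A} {F' : CompleteFlag b B}
    {u : Module.Basis (Fin a) ℂ A} {v : Module.Basis (Fin b) ℂ B}
    (hu : F.IsAdapted u) (hv : F'.IsAdapted v) :
    T.iotaSpace F F' = ((u.tensorProduct v).reindex T.entry).flag := by
  funext k
  rw [T.iotaSpace_eq_span hu hv, Module.Basis.flag]
  congr 1
  ext z
  constructor
  · rintro ⟨i, j, hk, rfl⟩
    exact ⟨T.entry (i, j), hk, by simp⟩
  · rintro ⟨m, hm, rfl⟩
    obtain ⟨⟨i, j⟩, rfl⟩ := T.entry.surjective m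
    exact ⟨i, j, hm, by simp⟩

/-- The equivariant map `ι_T : Fl(A) × Fl(B) → Fl(A ⊗ B)`, `(A_•, B_•) ↦ C_•`, where
`C_k = ∑_{T(i,j) ≤ k} A_i ⊗ B_j`, that is, `C_k = ⟨u_i ⊗ v_j, T(i,j) ≤ k⟩` for any bases
`u`, `v` adapted to `A_•`, `B_•`. -/
def iota (T : RectTableau a b) (A B : Type*) [AddCommGroup A] [Module ℂ A]
    [AddCommGroup B] [Module ℂ B] : EquivariantFlagMap a b A B where
  toFun y :=
    { space := T.iotaSpace y.1 y.2
      mono := by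
        obtain ⟨u, hu⟩ := y.1.exists_isAdapted
        obtain ⟨v, hv⟩ := y.2.exists_isAdapted
        rw [T.iotaSpace_eq_flag hu hv]
        exact Module.Basis.flag_mono _
      finrank_space := by
        obtain ⟨u, hu⟩ := y.1.exists_isAdapted
        obtain ⟨v, hv⟩ := y.2.exists_isAdapted
        rw [T.iotaSpace_eq_flag hu hv]
        exact CompleteFlag.finrank_basis_flag _
      space_zero := by
        obtain ⟨u, hu⟩ := y.1.exists_isAdapted
        obtain ⟨v, hv⟩ := y.2.exists_isAdapted
        rw [T.iotaSpace_eq_flag hu hv]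
        exact Module.Basis.flag_zero _
      space_last := by
        obtain ⟨u, hu⟩ := y.1.exists_isAdapted
        obtain ⟨v, hv⟩ := y.2.exists_isAdapted
        rw [T.iotaSpace_eq_flag hu hv]
        exact Module.Basis.flag_last _ }
  map_smul g h F F' := by
    ext k : 2
    rw [CompleteFlag.smul_space]
    simp only [iotaSpace]
    rw [Submodule.map_span]
    congr 1
    ext z
    constructor
    · rintro ⟨i, j, hk, _, ⟨x, hx, rfl⟩, _, ⟨y, hy, rfl⟩, rfl⟩
      exact ⟨x ⊗ₜ y, ⟨i, j, hk, x, hx, y, hy, rfl⟩, rfl⟩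
    · rintro ⟨_, ⟨i, j, hk, x, hx, y, hy, rfl⟩, rfl⟩
      exact ⟨i, j, hk, g x, ⟨x, hx, rfl⟩, h y, ⟨y, hy, rfl⟩, rfl⟩

end RectTableau

/-! ### Tangent spaces, differential and normal bundle -/

namespace CompleteFlag

variable {n : ℕ} {V : Type*} [AddCommGroup V] [Module ℂ V]

/-- The endomorphisms of `V` preserving the flag. -/
def stabEnd (F : CompleteFlag n V) : Submodule ℂ (Module.End ℂ V) where
  carrier := {X | ∀ i, F.space i ≤ (F.space i).comap X}
  zero_mem' i x _ := by simp
  add_mem' hX hY i x hx := Submodule.add_mem _ (hX i hx) (hY i hx)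
  smul_mem' c X hX i x hx := Submodule.smul_mem _ c (hX i hx)

/-- The tangent space `T_F Fl(V) = End(V) / {endomorphisms preserving F}`. -/
abbrev Tangent (F : CompleteFlag n V) : Type _ := Module.End ℂ V ⧸ F.stabEnd

/-- The adjoint representation `g ↦ (X ↦ g X g⁻¹)` of `GL(V)` on `End(V)`. -/
def adjoint (V : Type*) [AddCommGroup V] [Module ℂ V] :
    Representation ℂ (V ≃ₗ[ℂ] V) (Module.End ℂ V) :=
  Representation.linHom LinearEquiv.automorphismGroup.toLinearMapMonoidHom
    LinearEquiv.automorphismGroup.toLinearMapMonoidHom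

theorem adjoint_apply (g : V ≃ₗ[ℂ] V) (X : Module.End ℂ V) (x : V) :
    adjoint V g X x = g (X (g.symm x)) := rfl

/-- The stabilizer in `GL(V)` of the flag, a Borel subgroup. -/
abbrev borel (F : CompleteFlag n V) : Subgroup (V ≃ₗ[ℂ] V) :=
  MulAction.stabilizer (V ≃ₗ[ℂ] V) F

theorem apply_mem (F : CompleteFlag n V) (g : F.borel) (i : Fin (n + 1)) {x : V}
    (hx : x ∈ F.space i) : g.1 x ∈ F.space i := by
  have h : g.1 • F = F := g.2
  have h' : (g.1 • F).space i = F.space i := by rw [h]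
  exact h'.le ⟨x, hx, rfl⟩

theorem symm_apply_mem (F : CompleteFlag n V) (g : F.borel) (i : Fin (n + 1)) {x : V}
    (hx : x ∈ F.space i) : g.1.symm x ∈ F.space i :=
  F.apply_mem g⁻¹ i hx

theorem finiteDimensional (F : CompleteFlag n V) : FiniteDimensional ℂ V := by
  obtain ⟨u, -⟩ := F.exists_isAdapted
  exact Module.Finite.of_basis u

theorem exists_borel_of_mem_stabEnd (F : CompleteFlag n V) {X : Module.End ℂ V}
    (hX : X ∈ F.stabEnd) :
    ∃ c : ℂ, ∃ g ∈ F.borel, ∀ x, X x = (g : V ≃ₗ[ℂ] V) x + c • x := by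
  have := F.finiteDimensional
  obtain ⟨c, hc⟩ := (Module.End.finite_hasEigenvalue X).exists_notMem
  have hinj : Function.Injective (X - c • (1 : Module.End ℂ V)) := by
    rw [← LinearMap.ker_eq_bot]
    by_contra h
    apply hc
    rw [Set.mem_ofPred_eq, Module.End.hasEigenvalue_iff, Module.End.eigenspace_def]
    exact h
  have hg : ∀ x, LinearEquiv.ofInjectiveEndo _ hinj x = X x - c • x := fun x => by simp
  refine ⟨c, LinearEquiv.ofInjectiveEndo _ hinj, ?_, fun x => by simp⟩
  rw [MulAction.mem_stabilizer_iff]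
  ext i : 2
  rw [smul_space]
  refine Submodule.eq_of_le_of_finrank_eq ?_ (LinearEquiv.finrank_map_eq _ _)
  rintro _ ⟨x, hx, rfl⟩
  rw [LinearEquiv.coe_coe, hg]
  exact Submodule.sub_mem _ (hX i hx) (Submodule.smul_mem _ c hx)

/-- The isotropy representation of the stabilizer of `F` on the tangent space of `Fl(V)` at `F`. -/
def tangentRep (F : CompleteFlag n V) : Representation ℂ F.borel F.Tangent :=
  Representation.quotient ((adjoint V).comp F.borel.subtype) F.stabEnd fun g _ hX i _ hx =>
    F.apply_mem g i (hX i (F.symm_apply_mem g i hx))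

/-- The unipotent radical of the Borel subgroup stabilizing the flag: the elements of it which
act trivially on all the quotients `Vᵢ / Vᵢ₋₁`. -/
def unipotent (F : CompleteFlag n V) : Subgroup F.borel where
  carrier := {g | ∀ i : Fin n, ∀ x ∈ F.space i.succ, g.1 x - x ∈ F.space i.castSucc}
  one_mem' i x _ := by simp
  mul_mem' {g h} hg hh i x hx := by
    have h1 := hg i (h.1 x) (F.apply_mem h _ hx)
    have h2 := hh i x hx
    have := Submodule.add_mem _ h1 h2
    simpa using this
  inv_mem' {g} hg i x hx := by
    have h1 := hg i (g.1.symm x) (F.symm_apply_mem g _ hx)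
    have := Submodule.neg_mem _ h1
    simpa using this

instance (F : CompleteFlag n V) : F.unipotent.Normal where
  conj_mem u hu g i x hx := by
    have h1 := F.apply_mem g _ (hu i (g.1.symm x) (F.symm_apply_mem g _ hx))
    simpa using h1

end CompleteFlag

namespace EquivariantFlagMap

variable {a b : ℕ} {A B : Type*} [AddCommGroup A] [Module ℂ A] [AddCommGroup B] [Module ℂ B]

/-- The stabilizer `P` in `GL(A) × GL(B)` of a point `y` of `Fl(A) × Fl(B)`. -/
abbrev isotropy (y : CompleteFlag a A × CompleteFlag b B) :
    Subgroup ((A ≃ₗ[ℂ] A) × (B ≃ₗ[ℂ] B)) :=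
  y.1.borel.prod y.2.borel

/-- The homomorphism `(g, h) ↦ g ⊗ h` from the stabilizer of `y` to the stabilizer of `ι(y)`. -/
def isotropyHom (ι : EquivariantFlagMap a b A B) (y : CompleteFlag a A × CompleteFlag b B) :
    isotropy y →* (ι.toFun y).borel where
  toFun p := ⟨TensorProduct.congr p.1.1 p.1.2, by
    have h1 : p.1.1 • y.1 = y.1 := p.2.1
    have h2 : p.1.2 • y.2 = y.2 := p.2.2
    have := ι.map_smul p.1.1 p.1.2 y.1 y.2
    rw [h1, h2] at this
    exact this.symm⟩
  map_one' := Subtype.ext (TensorProduct.congr_refl_refl (R := ℂ) (M := A) (N := B))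
  map_mul' p q := Subtype.ext (TensorProduct.congr_mul p.1.1 p.1.2 q.1.1 q.1.2)

theorem isotropyHom_apply (ι : EquivariantFlagMap a b A B)
    (y : CompleteFlag a A × CompleteFlag b B) (p : isotropy y) :
    (ι.isotropyHom y p).1 = TensorProduct.congr p.1.1 p.1.2 := rfl

/-- The action of `P` on the tangent space of `Fl(A ⊗ B)` at `ι(y)`. -/
def pullbackTangentRep (ι : EquivariantFlagMap a b A B)
    (y : CompleteFlag a A × CompleteFlag b B) :
    Representation ℂ (isotropy y) (ι.toFun y).Tangent :=
  (ι.toFun y).tangentRep.comp (ι.isotropyHom y)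

theorem rTensor_mem (ι : EquivariantFlagMap a b A B) (y : CompleteFlag a A × CompleteFlag b B) :
    y.1.stabEnd ≤ (ι.toFun y).stabEnd.comap (LinearMap.rTensorHom B) := by
  intro X hX i
  obtain ⟨c, g, hg, hgX⟩ := y.1.exists_borel_of_mem_stabEnd hX
  have h2 : LinearMap.rTensorHom B X =
      (TensorProduct.congr g 1 : A ⊗[ℂ] B ≃ₗ[ℂ] A ⊗[ℂ] B).toLinearMap + c • LinearMap.id := by
    ext x w
    simp [hgX, TensorProduct.add_tmul, TensorProduct.smul_tmul']
  intro z hz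
  rw [Submodule.mem_comap, h2]
  exact Submodule.add_mem _ ((ι.toFun y).apply_mem
    (ι.isotropyHom y ⟨(g, 1), Subgroup.mem_prod.mpr ⟨hg, one_mem _⟩⟩) i hz)
    (Submodule.smul_mem _ c hz)

theorem lTensor_mem (ι : EquivariantFlagMap a b A B) (y : CompleteFlag a A × CompleteFlag b B) :
    y.2.stabEnd ≤ (ι.toFun y).stabEnd.comap (LinearMap.lTensorHom A) := by
  intro X hX i
  obtain ⟨c, g, hg, hgX⟩ := y.2.exists_borel_of_mem_stabEnd hX
  have h2 : LinearMap.lTensorHom A X =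
      (TensorProduct.congr 1 g : A ⊗[ℂ] B ≃ₗ[ℂ] A ⊗[ℂ] B).toLinearMap + c • LinearMap.id := by
    ext x w
    simp [hgX, TensorProduct.tmul_add, TensorProduct.tmul_smul]
  intro z hz
  rw [Submodule.mem_comap, h2]
  exact Submodule.add_mem _ ((ι.toFun y).apply_mem
    (ι.isotropyHom y ⟨(1, g), Subgroup.mem_prod.mpr ⟨one_mem _, hg⟩⟩) i hz)
    (Submodule.smul_mem _ c hz)

/-- The differential of `ι` at `y`, from `T_{A_•} Fl(A) × T_{B_•} Fl(B)` to the tangent space of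
`Fl(A ⊗ B)` at `ι(y)`. By equivariance, it is induced by the map `(X, Y) ↦ X ⊗ 1 + 1 ⊗ Y`, the
differential of `(g, h) ↦ g ⊗ h`. -/
def differential (ι : EquivariantFlagMap a b A B) (y : CompleteFlag a A × CompleteFlag b B) :
    y.1.Tangent × y.2.Tangent →ₗ[ℂ] (ι.toFun y).Tangent :=
  LinearMap.coprod
    (Submodule.mapQ _ _ (LinearMap.rTensorHom B) (ι.rTensor_mem y))
    (Submodule.mapQ _ _ (LinearMap.lTensorHom A) (ι.lTensor_mem y))

/-- An equivariant map between these homogeneous projective varieties is an embedding (a closed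
immersion) when it is injective with everywhere injective differential. -/
def IsEmbedding (ι : EquivariantFlagMap a b A B) : Prop :=
  Function.Injective ι.toFun ∧ ∀ y, Function.Injective (ι.differential y)

/-- The fibre at `y` of the normal bundle `N = ι^*T Fl(A ⊗ B) / T(Fl(A) × Fl(B))`. -/
abbrev Normal (ι : EquivariantFlagMap a b A B) (y : CompleteFlag a A × CompleteFlag b B) : Type _ :=
  (ι.toFun y).Tangent ⧸ LinearMap.range (ι.differential y)

theorem differential_equivariant (ι : EquivariantFlagMap a b A B)
    (y : CompleteFlag a A × CompleteFlag b B) (p : isotropy y) (X : Module.End ℂ A)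
    (Y : Module.End ℂ B) :
    ι.pullbackTangentRep y p (ι.differential y (Submodule.Quotient.mk X, Submodule.Quotient.mk Y)) =
      ι.differential y (Submodule.Quotient.mk (CompleteFlag.adjoint A p.1.1 X),
        Submodule.Quotient.mk (CompleteFlag.adjoint B p.1.2 Y)) := by
  change Submodule.Quotient.mk (CompleteFlag.adjoint (A ⊗[ℂ] B) (TensorProduct.congr p.1.1 p.1.2)
      (LinearMap.rTensorHom B X + LinearMap.lTensorHom A Y)) =
    Submodule.Quotient.mk (LinearMap.rTensorHom B (CompleteFlag.adjoint A p.1.1 X) +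
      LinearMap.lTensorHom A (CompleteFlag.adjoint B p.1.2 Y))
  congr 1
  ext x w
  simp [CompleteFlag.adjoint_apply]

/-- The `P`-module `N_y` defining the homogeneous vector bundle `N`. -/
def normalRep (ι : EquivariantFlagMap a b A B) (y : CompleteFlag a A × CompleteFlag b B) :
    Representation ℂ (isotropy y) (ι.Normal y) :=
  Representation.quotient (ι.pullbackTangentRep y) (LinearMap.range (ι.differential y)) (by
    rintro p _ ⟨⟨X, Y⟩, rfl⟩
    induction X using Submodule.Quotient.induction_on with | H X => ?_
    induction Y using Submodule.Quotient.induction_on with | H Y => ?_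
    rw [Submodule.mem_comap, differential_equivariant]
    exact LinearMap.mem_range_self _ _)

/-- The `P`-module `N_y^*` defining the conormal bundle `N^*`. -/
def conormalRep (ι : EquivariantFlagMap a b A B) (y : CompleteFlag a A × CompleteFlag b B) :
    Representation ℂ (isotropy y) (Module.Dual ℂ (ι.Normal y)) :=
  (ι.normalRep y).dual

/-- The unipotent radical of `P`. -/
def unipotentRadical (y : CompleteFlag a A × CompleteFlag b B) : Subgroup (isotropy y) where
  carrier := {p | ⟨p.1.1, p.2.1⟩ ∈ y.1.unipotent ∧ ⟨p.1.2, p.2.2⟩ ∈ y.2.unipotent}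
  one_mem' := ⟨one_mem _, one_mem _⟩
  mul_mem' hp hq := ⟨mul_mem hp.1 hq.1, mul_mem hp.2 hq.2⟩
  inv_mem' hp := ⟨inv_mem hp.1, inv_mem hp.2⟩

instance (y : CompleteFlag a A × CompleteFlag b B) : (unipotentRadical y).Normal where
  conj_mem _ hu g :=
    ⟨Subgroup.Normal.conj_mem inferInstance _ hu.1 ⟨g.1.1, g.2.1⟩,
      Subgroup.Normal.conj_mem inferInstance _ hu.2 ⟨g.1.2, g.2.2⟩⟩

end EquivariantFlagMap

/-! ### Associated graded modules and symmetric algebras -/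

namespace GradedModule

variable {P M : Type*} [Group P] [AddCommGroup M] [Module ℂ M]
  (ρ : Representation ℂ P M) (U : Subgroup P)

/-- The canonical increasing filtration of a `P`-module `M` with respect to a normal subgroup `U`
of `P`: `F₀ = 0`, and `Fᵢ₊₁ / Fᵢ` is the space of `U`-invariants of `M / Fᵢ`. -/
def filtration : ℕ → Submodule ℂ M
  | 0 => ⊥
  | i + 1 =>
    { carrier := {x | ∀ u ∈ U, ρ u x - x ∈ filtration i}
      zero_mem' := fun _ _ => by simp
      add_mem' := fun {x x'} hx hx' u hu => by
        have := Submodule.add_mem _ (hx u hu) (hx' u hu)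
        rw [map_add]
        convert this using 1
        abel
      smul_mem' := fun c x hx u hu => by
        have := Submodule.smul_mem _ c (hx u hu)
        rw [map_smul, ← smul_sub]
        exact this }

theorem filtration_le [U.Normal] (i : ℕ) (g : P) :
    filtration ρ U i ≤ (filtration ρ U i).comap (ρ g) := by
  induction i generalizing g with
  | zero =>
    intro x hx
    have h0 : x = 0 := hx
    subst h0
    exact Submodule.zero_mem _
  | succ i ih =>
    intro x hx u hu
    have h1 := ih g (hx (g⁻¹ * u * g) (by simpa using Subgroup.Normal.conj_mem ‹_› u hu g⁻¹))
    have h2 : ρ u (ρ g x) - ρ g x = ρ g (ρ (g⁻¹ * u * g) x - x) := by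
      rw [map_sub, ← Module.End.mul_apply, ← Module.End.mul_apply, ← map_mul, ← map_mul]
      simp [mul_assoc]
    change ρ u (ρ g x) - ρ g x ∈ _
    rw [h2]
    exact h1

/-- The graded piece `Fᵢ₊₁ / Fᵢ`. -/
abbrev Piece (i : ℕ) : Type _ :=
  filtration ρ U (i + 1) ⧸ (filtration ρ U i).submoduleOf (filtration ρ U (i + 1))

/-- The `P`-module `Fᵢ₊₁ / Fᵢ`. -/
def pieceRep [U.Normal] (i : ℕ) : Representation ℂ P (Piece ρ U i) :=
  Representation.quotient
    (Representation.subrepresentation ρ (filtration ρ U (i + 1)) (filtration_le ρ U (i + 1)))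
    ((filtration ρ U i).submoduleOf (filtration ρ U (i + 1)))
    fun g _ hx => filtration_le ρ U i g hx

/-- The associated graded `P`-module `gr(M) = ⨁ᵢ Fᵢ₊₁ / Fᵢ`. -/
abbrev Gr : Type _ := DirectSum ℕ (Piece ρ U)

/-- The action of `P` on `gr(M)`. -/
def grRep [U.Normal] : Representation ℂ P (Gr ρ U) :=
  Representation.directSum (pieceRep ρ U)

end GradedModule

namespace SymmetricAlgebra

/-- The action of `P` by algebra automorphisms on the symmetric algebra `S^*(M)` of a
`P`-module `M`. -/
def rep {P M : Type*} [Group P] [AddCommMonoid M] [Module ℂ M] (ρ : Representation ℂ P M) :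
    Representation ℂ P (SymmetricAlgebra ℂ M) where
  toFun g := (lift (ι ℂ M ∘ₗ ρ g)).toLinearMap
  map_one' := by
    rw [map_one]
    change (lift (ι ℂ M)).toLinearMap = _
    rw [lift_ι]
    rfl
  map_mul' g h := by
    have key : lift (ι ℂ M ∘ₗ ρ (g * h)) = (lift (ι ℂ M ∘ₗ ρ g)).comp (lift (ι ℂ M ∘ₗ ρ h)) := by
      apply algHom_ext
      ext x
      simp
    rw [key]
    rfl

/-- The positive degree part of the symmetric algebra `S^*(M)`, that is, its augmentation ideal. -/
def positivePart (M : Type*) [AddCommMonoid M] [Module ℂ M] : Submodule ℂ (SymmetricAlgebra ℂ M) :=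
  LinearMap.ker (algebraMapInv (R := ℂ) (M := M)).toLinearMap

end SymmetricAlgebra

/-! ### Weights and the stabilizing property -/

namespace EquivariantFlagMap

/-- The automorphism of `V` which is diagonal in a given basis, with given eigenvalues. -/
def diag {n : ℕ} {V : Type*} [AddCommGroup V] [Module ℂ V] (u : Module.Basis (Fin n) ℂ V) :
    (Fin n → ℂˣ) →* (V ≃ₗ[ℂ] V) where
  toFun t := u.equiv (u.unitsSMul t) (Equiv.refl _)
  map_one' := by
    apply LinearEquiv.toLinearMap_injective
    refine u.ext fun i => ?_
    simp [Module.Basis.unitsSMul_apply]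
  map_mul' t s := by
    apply LinearEquiv.toLinearMap_injective
    refine u.ext fun i => ?_
    simp [Module.Basis.unitsSMul_apply, Units.smul_def, smul_smul, mul_comm]

theorem diag_apply {n : ℕ} {V : Type*} [AddCommGroup V] [Module ℂ V]
    (u : Module.Basis (Fin n) ℂ V) (t : Fin n → ℂˣ) (i : Fin n) :
    diag u t (u i) = (t i : ℂ) • u i := by
  simp [diag, Module.Basis.unitsSMul_apply, Units.smul_def]

theorem diag_mem_borel {n : ℕ} {V : Type*} [AddCommGroup V] [Module ℂ V] {F : CompleteFlag n V}
    {u : Module.Basis (Fin n) ℂ V} (hu : F.IsAdapted u) (t : Fin n → ℂˣ) :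
    diag u t ∈ F.borel := by
  have := F.finiteDimensional
  rw [MulAction.mem_stabilizer_iff]
  ext i : 2
  rw [CompleteFlag.smul_space]
  refine Submodule.eq_of_le_of_finrank_eq ?_ (LinearEquiv.finrank_map_eq _ _)
  rw [hu, Submodule.map_le_iff_le_comap, Module.Basis.flag_le_iff]
  intro j hj
  rw [Submodule.mem_comap, LinearEquiv.coe_coe, diag_apply]
  exact Submodule.smul_mem _ _ (u.self_mem_flag hj)

variable {a b : ℕ} {A B : Type*} [AddCommGroup A] [Module ℂ A] [AddCommGroup B] [Module ℂ B]

/-- The Levi subgroup `L` of `P` attached to adapted bases: `P` being a Borel subgroup, `L` is the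
maximal torus of the pairs of automorphisms that are diagonal in the given bases. It is
parametrized by the pairs of tuples of eigenvalues. -/
def levi {y : CompleteFlag a A × CompleteFlag b B} {u : Module.Basis (Fin a) ℂ A}
    {v : Module.Basis (Fin b) ℂ B} (hu : y.1.IsAdapted u) (hv : y.2.IsAdapted v) :
    (Fin a → ℂˣ) × (Fin b → ℂˣ) →* isotropy y :=
  ((diag u).prodMap (diag v)).codRestrict (isotropy y) fun t =>
    Subgroup.mem_prod.mpr ⟨diag_mem_borel hu t.1, diag_mem_borel hv t.2⟩

/-- The weight lattice of `L`, with basis `e₁, …, e_a, f₁, …, f_b`. -/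
abbrev WeightLattice (a b : ℕ) : Type := (Fin a → ℤ) × (Fin b → ℤ)

/-- The character `(t, s) ↦ ∏ t_i ^ m_i ∏ s_j ^ n_j` of weight `(m, n)`. -/
def weightChar (w : WeightLattice a b) (t : (Fin a → ℂˣ) × (Fin b → ℂˣ)) : ℂˣ :=
  (∏ i, t.1 i ^ w.1 i) * ∏ j, t.2 j ^ w.2 j

/-- The weights of (a submodule `S` of) an `L`-module `M`. As `L` is a torus, its irreducible
modules are one-dimensional and these are also the highest weights. -/
def weights {M : Type*} [AddCommMonoid M] [Module ℂ M]
    (ρ : Representation ℂ ((Fin a → ℂˣ) × (Fin b → ℂˣ)) M) (S : Submodule ℂ M) :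
    Set (WeightLattice a b) :=
  {w | ∃ x ∈ S, x ≠ 0 ∧ ∀ t, ρ t x = (weightChar w t : ℂ) • x}

/-- `S^*(gr(N^*))` at `y`, as an `L`-module. -/
def symGrConormalRep (ι : EquivariantFlagMap a b A B) {y : CompleteFlag a A × CompleteFlag b B}
    {u : Module.Basis (Fin a) ℂ A} {v : Module.Basis (Fin b) ℂ B} (hu : y.1.IsAdapted u)
    (hv : y.2.IsAdapted v) :
    Representation ℂ ((Fin a → ℂˣ) × (Fin b → ℂˣ))
      (SymmetricAlgebra ℂ (GradedModule.Gr (ι.conormalRep y) (unipotentRadical y))) :=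
  (SymmetricAlgebra.rep (GradedModule.grRep (ι.conormalRep y) (unipotentRadical y))).comp
    (levi hu hv)

/-- `ι` is stabilizing if, for every point `y` of `Fl(A) × Fl(B)`, with stabilizer `P`, and every
Levi factor `L` of `P`, the highest weights of the positive degree part of `S^*(gr(N^*))`, as an
`L`-module, are contained in some open half space `{ℓ > 0}` of the weight lattice of `L`. -/
def IsStabilizing (ι : EquivariantFlagMap a b A B) : Prop :=
  ∀ (y : CompleteFlag a A × CompleteFlag b B) (u : Module.Basis (Fin a) ℂ A)
    (v : Module.Basis (Fin b) ℂ B) (hu : y.1.IsAdapted u) (hv : y.2.IsAdapted v),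
    ∃ ℓ : WeightLattice a b →+ ℝ, ℓ ≠ 0 ∧
      ∀ w ∈ weights (ι.symGrConormalRep hu hv) (SymmetricAlgebra.positivePart _), 0 < ℓ w

end EquivariantFlagMap

end

/-! For the classification, fix a point `y` of `Fl(A) × Fl(B)` with adapted bases `u`, `v`. The
source is homogeneous, so an equivariant map is determined by its value `C_•` at `y`, a flag stable
under the stabilizer `P`, hence under its Lie algebra. Stability under the diagonal matrix units
makes each `C_k` a span of vectors `u_i ⊗ v_j`, so `C_•` amounts to a numbering of the boxes;
stability under the off-diagonal matrix units preserving the two flags makes the numbering increase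
along rows and columns (`exists_eq_iota`). Conversely `A_i` and `B_j` can be recovered from
`ι_T(A_•, B_•)` by contracting with a linear form on the other factor, at the step where the first
box of row `i` or column `j` enters; the same contraction gives injectivity of the differential.

For the stabilizing property, pulling back along `End(A ⊗ B) → N` embeds `N^*` in `End(A ⊗ B)^*`,
where the matrix coefficients are weight vectors of weights `e_k + f_l - e_i - f_j`. Only those with
`T(k,l) < T(i,j)` contribute to `N^*`. By independence of characters, eigenvectors in subquotients
and in the positive part of the symmetric algebra have as characters products of such weights, so
additivity of `T` provides the half space (`conormalRep_mem_charSpan`, `pos_of_mem_weights`).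

Conversely, if `a, b > 1`, all these weights except possibly the zero ones do occur in `N^*`: if the
two boxes share neither row nor column, the coefficient itself kills `X ⊗ 1 + 1 ⊗ Y`; if they share
a column (or row), the difference of two coefficients of equal weight, taken in two different
columns (or rows), does. They pass to `gr(N^*)` because the canonical filtration is exhaustive. A
half space functional `ℓ` then gives `x_i = -ℓ(e_i)` and `y_j = -ℓ(f_j)`. If `a = 1` or `b = 1`,
every tableau is additive. -/

noncomputable section

/-! ### Simultaneous eigenvectors and independence of characters -/

namespace Representation

section Isotypic

variable {G M M' : Type*} [Monoid G] [AddCommMonoid M] [Module ℂ M] [AddCommMonoid M'] [Module ℂ M']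

/-- The simultaneous eigenvectors of a representation with a given character. -/
def charSpace (ρ : Representation ℂ G M) (χ : G →* ℂ) : Submodule ℂ M where
  carrier := {x | ∀ g, ρ g x = χ g • x}
  zero_mem' g := by simp
  add_mem' hx hy g := by rw [map_add, hx g, hy g, smul_add]
  smul_mem' c x hx g := by rw [map_smul, hx g, smul_comm]

/-- The span of the simultaneous eigenvectors whose character belongs to `K`. -/
def charSpan (ρ : Representation ℂ G M) (K : Set (G →* ℂ)) : Submodule ℂ M :=
  ⨆ χ : K, ρ.charSpace χ

theorem mem_charSpan_of_mem {ρ : Representation ℂ G M} {K : Set (G →* ℂ)} {χ : G →* ℂ}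
    (hχ : χ ∈ K) {x : M} (hx : x ∈ ρ.charSpace χ) : x ∈ ρ.charSpan K :=
  Submodule.mem_iSup_of_mem (p := fun χ : K => ρ.charSpace χ) ⟨χ, hχ⟩ hx

theorem map_mem_charSpan {ρ : Representation ℂ G M} {ρ' : Representation ℂ G M'}
    {K : Set (G →* ℂ)} (f : M →ₗ[ℂ] M') (hfρ : ∀ g x, f (ρ g x) = ρ' g (f x)) {x : M}
    (hx : x ∈ ρ.charSpan K) : f x ∈ ρ'.charSpan K := by
  have h : ρ.charSpan K ≤ (ρ'.charSpan K).comap f :=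
    iSup_le fun χ y hy => mem_charSpan_of_mem χ.2 fun g => by rw [← hfρ, hy g, map_smul]
  exact h hx

theorem apply_sum_eq {ρ : Representation ℂ G M} {K : Set (G →* ℂ)} {f : K →₀ M}
    (hf : ∀ χ : K, f χ ∈ ρ.charSpace χ) (φ : Module.Dual ℂ M) (g : G) :
    φ (ρ g (f.sum fun _ x => x)) = ∑ χ ∈ f.support, φ (f χ) * (χ : G →* ℂ) g := by
  simp only [Finsupp.sum, map_sum]
  refine Finset.sum_congr rfl fun χ _ => ?_
  rw [hf χ g, map_smul, smul_eq_mul, mul_comm]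

/-- Applying to the orbit of `x` a linear form that is nonzero at `x` turns a decomposition of `x`
into eigenvectors into an expression of `χ` as a linear combination of elements of `K`; Dedekind's
independence of characters forbids this when `χ ∉ K`. -/
theorem mem_of_mem_charSpan {ρ : Representation ℂ G M} {K : Set (G →* ℂ)} {χ : G →* ℂ} {x : M}
    (hx : x ∈ ρ.charSpan K) (hχ : x ∈ ρ.charSpace χ) (h0 : x ≠ 0) : χ ∈ K := by
  obtain ⟨f, hf, rfl⟩ := (Submodule.mem_iSup_iff_exists_finsupp _ _).mp hx
  by_contra hK
  let _ : AddCommGroup M := Module.addCommMonoidToAddCommGroup ℂ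
  obtain ⟨φ, hφ, -⟩ := Submodule.exists_le_ker_of_notMem
    (p := (⊥ : Submodule ℂ M)) (v := f.sum fun _ x => x) (by simpa using h0)
  have hli := linearIndependent_monoidHom G ℂ
  have hmem : (fun g => χ g) ∈ Submodule.span ℂ ((fun (ψ : G →* ℂ) g => ψ g) '' K) := by
    have h1 : (φ (f.sum fun _ x => x)) • (fun g => χ g) =
        ∑ ψ ∈ f.support, φ (f ψ) • fun g => (ψ : G →* ℂ) g := by
      ext g
      have h2 := apply_sum_eq hf φ g
      rw [hχ g, map_smul] at h2
      simp only [Pi.smul_apply, smul_eq_mul, Finset.sum_apply] at h2 ⊢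
      rw [mul_comm, h2]
    rw [← Submodule.smul_mem_iff _ hφ, h1]
    exact Submodule.sum_mem _ fun ψ _ => Submodule.smul_mem _ _
      (Submodule.subset_span ⟨ψ, ψ.2, rfl⟩)
  exact hli.notMem_span_image hK hmem

end Isotypic

section Independence

variable {G M M' : Type*} [Monoid G] [AddCommGroup M] [Module ℂ M] [AddCommGroup M'] [Module ℂ M']

theorem linearIndependent_coe_subtype (K : Set (G →* ℂ)) :
    LinearIndependent ℂ (fun (χ : K) (g : G) => (χ : G →* ℂ) g) :=
  (linearIndependent_monoidHom G ℂ).comp (fun χ : K => (χ : G →* ℂ)) Subtype.val_injective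

/-- A subrepresentation contains the isotypic components of its elements: a linear form vanishing on
the subrepresentation but not on some component would yield a nontrivial linear relation between
distinct characters. -/
theorem mem_charSpan_of_injective {ρ : Representation ℂ G M} {ρ' : Representation ℂ G M'}
    {K : Set (G →* ℂ)} (f : M →ₗ[ℂ] M') (hf : Function.Injective f)
    (hfρ : ∀ g x, f (ρ g x) = ρ' g (f x)) {x : M} (hx : f x ∈ ρ'.charSpan K) :
    x ∈ ρ.charSpan K := by
  obtain ⟨c, hc, hcx⟩ := (Submodule.mem_iSup_iff_exists_finsupp _ _).mp hx
  have hmem : ∀ χ, c χ ∈ LinearMap.range f := by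
    intro χ
    by_contra hχ
    obtain ⟨φ, hφ, hker⟩ := Submodule.exists_le_ker_of_notMem hχ
    have hs : χ ∈ c.support := by
      rw [Finsupp.mem_support_iff]
      rintro h
      exact hφ (by rw [h, map_zero])
    refine hφ (linearIndependent_iff'.mp (linearIndependent_coe_subtype K) c.support
      (fun ψ => φ (c ψ)) ?_ χ hs)
    ext g
    have h2 := apply_sum_eq hc φ g
    rw [hcx, ← hfρ] at h2
    have h3 : φ (f (ρ g x)) = 0 := hker (LinearMap.mem_range_self _ _)
    simp only [Pi.smul_apply, smul_eq_mul, Finset.sum_apply, Pi.zero_apply]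
    rw [← h2, h3]
  choose d hd using hmem
  have hxd : x = ∑ χ ∈ c.support, d χ := by
    apply hf
    rw [map_sum, ← hcx]
    exact Finset.sum_congr rfl fun χ _ => (hd χ).symm
  rw [hxd]
  refine Submodule.sum_mem _ fun χ _ => mem_charSpan_of_mem χ.2 fun g => hf ?_
  rw [hfρ, hd, hc χ g, map_smul, hd]

end Independence

end Representation

/-! ### Characters in the positive part of the symmetric algebra -/

namespace SymmetricAlgebra

open Representation

variable {P M : Type*} [Group P] [AddCommMonoid M] [Module ℂ M]

theorem rep_ι (ρ : Representation ℂ P M) (g : P) (x : M) :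
    rep ρ g (ι ℂ M x) = ι ℂ M (ρ g x) := by
  change lift (ι ℂ M ∘ₗ ρ g) (ι ℂ M x) = _
  rw [lift_ι_apply]
  rfl

theorem rep_mul (ρ : Representation ℂ P M) (g : P) (x y : SymmetricAlgebra ℂ M) :
    rep ρ g (x * y) = rep ρ g x * rep ρ g y :=
  map_mul (lift (ι ℂ M ∘ₗ ρ g)) x y

/-- Linear forms separate the points of `M` and extend to algebra homomorphisms on `S^*(M)`. -/
theorem ι_injective : Function.Injective (ι ℂ M) := by
  let _ : AddCommGroup M := Module.addCommMonoidToAddCommGroup ℂ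
  intro x y hxy
  by_contra h0
  obtain ⟨φ, hφ, -⟩ := Submodule.exists_le_ker_of_notMem
    (p := (⊥ : Submodule ℂ M)) (v := x - y) (by simpa [sub_eq_zero] using h0)
  apply hφ
  rw [map_sub, ← lift_ι_apply φ x, hxy, lift_ι_apply, sub_self]

theorem ι_mem_positivePart (x : M) : ι ℂ M x ∈ positivePart M :=
  algebraMapInv_ι x

theorem charSpan_mul_mem {G : Type*} [Monoid G] (f : G →* P) (ρ : Representation ℂ P M)
    {K : Set (G →* ℂ)} (hK : ∀ χ ∈ K, ∀ ψ ∈ K, χ * ψ ∈ K) {x y : SymmetricAlgebra ℂ M}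
    (hx : x ∈ charSpan ((rep ρ).comp f) K) (hy : y ∈ charSpan ((rep ρ).comp f) K) :
    x * y ∈ charSpan ((rep ρ).comp f) K := by
  have h1 : charSpan ((rep ρ).comp f) K ≤
      (charSpan ((rep ρ).comp f) K).comap (LinearMap.mulRight ℂ y) := by
    refine iSup_le fun χ z hz => ?_
    have h2 : charSpan ((rep ρ).comp f) K ≤
        (charSpan ((rep ρ).comp f) K).comap (LinearMap.mulLeft ℂ z) := by
      refine iSup_le fun ψ w hw => mem_charSpan_of_mem (hK χ χ.2 ψ ψ.2) fun g => ?_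
      have e1 : rep ρ (f g) z = (χ : G →* ℂ) g • z := hz g
      have e2 : rep ρ (f g) w = (ψ : G →* ℂ) g • w := hw g
      change rep ρ (f g) (z * w) = ((χ : G →* ℂ) g * (ψ : G →* ℂ) g) • (z * w)
      rw [rep_mul, e1, e2, smul_mul_smul_comm]
    exact h2 hy
  exact h1 hx

/-- The augmentation ideal is spanned by nonempty products of elements of `M`, and `K` is stable
under products. -/
theorem positivePart_le_charSpan {G : Type*} [Monoid G] (f : G →* P) (ρ : Representation ℂ P M)
    {K : Set (G →* ℂ)} (hK : ∀ χ ∈ K, ∀ ψ ∈ K, χ * ψ ∈ K)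
    (h : ∀ x, x ∈ charSpan (ρ.comp f) K) :
    positivePart M ≤ charSpan ((rep ρ).comp f) K := by
  -- Constants carry the trivial character, which need not lie in `K`. Subtracting the augmentation
  -- removes them and gives a statement that can be proved by induction over all of `S^*(M)`.
  have key : ∀ x : SymmetricAlgebra ℂ M,
      x - algebraMap ℂ _ (algebraMapInv x) ∈ charSpan ((rep ρ).comp f) K := by
    intro x
    induction x using SymmetricAlgebra.induction with
    | algebraMap r => simp [algebraMap_leftInverse M r]
    | ι x =>
      rw [algebraMapInv_ι, map_zero, sub_zero]
      exact map_mem_charSpan (ρ := ρ.comp f) (ι ℂ M) (fun g y => (rep_ι ρ (f g) y).symm) (h x)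
    | add x y hx hy =>
      convert Submodule.add_mem _ hx hy using 1
      rw [map_add, map_add]
      abel
    | mul x y hx hy =>
      have e : x * y - algebraMap ℂ _ (algebraMapInv (x * y)) =
          (x - algebraMap ℂ _ (algebraMapInv x)) * (y - algebraMap ℂ _ (algebraMapInv y)) +
          (algebraMapInv x : ℂ) • (y - algebraMap ℂ _ (algebraMapInv y)) +
          (algebraMapInv y : ℂ) • (x - algebraMap ℂ _ (algebraMapInv x)) := by
        rw [map_mul, map_mul, Algebra.smul_def, Algebra.smul_def]
        ring
      rw [e]
      exact Submodule.add_mem _ (Submodule.add_mem _ (charSpan_mul_mem f ρ hK hx hy)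
        (Submodule.smul_mem _ _ hy)) (Submodule.smul_mem _ _ hx)
  intro x hx
  have h1 := key x
  have h2 : algebraMapInv x = 0 := hx
  rwa [h2, map_zero, sub_zero] at h1

end SymmetricAlgebra

/-! ### Passing characters between a module and its associated graded -/

namespace GradedModule

open Representation

variable {P M : Type*} [Group P] [AddCommGroup M] [Module ℂ M]
  (ρ : Representation ℂ P M) (U : Subgroup P)

/-- Each graded piece is a quotient of a subrepresentation of `M`, and being spanned by eigenvectors
with characters in `K` passes to both. -/
theorem gr_mem_charSpan [U.Normal] {G : Type*} [Monoid G] (f : G →* P) {K : Set (G →* ℂ)}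
    (h : ∀ x, x ∈ charSpan (ρ.comp f) K) (x : Gr ρ U) :
    x ∈ charSpan (M := Gr ρ U) ((grRep ρ U).comp f) K := by
  induction x using DirectSum.induction_on with
  | zero => exact Submodule.zero_mem _
  | add x y hx hy => exact Submodule.add_mem _ hx hy
  | of i x =>
    refine map_mem_charSpan (ρ := (pieceRep ρ U i).comp f)
      (DirectSum.lof ℂ ℕ (Piece ρ U) i) (fun g y => ?_) ?_
    · exact (DirectSum.lmap_lof (fun j => pieceRep ρ U j (f g)) i y).symm
    · obtain ⟨z, rfl⟩ := Submodule.Quotient.mk_surjective _ x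
      refine map_mem_charSpan (ρ := (subrepresentation ρ (filtration ρ U (i + 1))
        (filtration_le ρ U (i + 1))).comp f) (Submodule.mkQ _) (fun g y => rfl) ?_
      exact mem_charSpan_of_injective (ρ' := ρ.comp f) (Submodule.subtype _)
        Subtype.val_injective (fun g y => rfl) (h z)

/-- If the canonical filtration is exhaustive, every nonzero simultaneous eigenvector of `M`
yields one of `gr(M)`. -/
theorem exists_gr_mem_charSpace [U.Normal] {G : Type*} [Monoid G] (f : G →* P) {χ : G →* ℂ}
    {n : ℕ} (hn : filtration ρ U n = ⊤) {x : M} (hx : x ∈ charSpace (ρ.comp f) χ)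
    (h0 : x ≠ 0) : ∃ z : Gr ρ U,
      z ∈ charSpace (M := Gr ρ U) ((grRep ρ U).comp f) χ ∧ z ≠ 0 := by
  classical
  have hex : ∃ i, x ∈ filtration ρ U i := ⟨n, by rw [hn]; trivial⟩
  -- Taking the least index whose filtration step contains `x` makes the class of `x` in that graded
  -- piece nonzero. The index is positive since `F₀ = 0` and `x ≠ 0`.
  obtain ⟨i, hi⟩ : ∃ i, Nat.find hex = i + 1 := by
    refine Nat.exists_eq_succ_of_ne_zero fun h => h0 ?_
    have := Nat.find_spec hex
    rw [h] at this
    exact this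
  have h1 : x ∈ filtration ρ U (i + 1) := hi ▸ Nat.find_spec hex
  have h2 : x ∉ filtration ρ U i := Nat.find_min hex (by omega)
  refine ⟨DirectSum.lof ℂ ℕ (Piece ρ U) i (Submodule.Quotient.mk ⟨x, h1⟩), fun g => ?_, ?_⟩
  · refine (DirectSum.lmap_lof (fun j => pieceRep ρ U j (f g)) i _).trans ?_
    rw [← map_smul]
    congr 1
    change Submodule.Quotient.mk _ = Submodule.Quotient.mk _
    congr 1
    exact Subtype.ext (hx g)
  · intro h
    have h3 := DirectSum.of_injective (β := Piece ρ U) i (h.trans (map_zero _).symm)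
    rw [Submodule.Quotient.mk_eq_zero] at h3
    exact h2 h3

theorem mem_of_mem_positivePart [U.Normal] {G : Type*} [Monoid G] (f : G →* P)
    {K : Set (G →* ℂ)} (hK : ∀ χ ∈ K, ∀ ψ ∈ K, χ * ψ ∈ K)
    (h : ∀ x, x ∈ charSpan (ρ.comp f) K) {χ : G →* ℂ} {z : SymmetricAlgebra ℂ (Gr ρ U)}
    (hz : z ∈ SymmetricAlgebra.positivePart (Gr ρ U)) (h0 : z ≠ 0)
    (hχ : ∀ g, SymmetricAlgebra.rep (grRep ρ U) (f g) z = χ g • z) : χ ∈ K :=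
  mem_of_mem_charSpan (SymmetricAlgebra.positivePart_le_charSpan f (grRep ρ U) hK
    (gr_mem_charSpan ρ U f h) hz) hχ h0

theorem exists_mem_positivePart [U.Normal] {G : Type*} [Monoid G] (f : G →* P) {χ : G →* ℂ}
    {n : ℕ} (hn : filtration ρ U n = ⊤) {x : M} (hx : x ∈ charSpace (ρ.comp f) χ)
    (h0 : x ≠ 0) : ∃ z ∈ SymmetricAlgebra.positivePart (Gr ρ U), z ≠ 0 ∧
      ∀ g, SymmetricAlgebra.rep (grRep ρ U) (f g) z = χ g • z := by
  obtain ⟨z, hz, hz0⟩ := exists_gr_mem_charSpace ρ U f hn hx h0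
  refine ⟨SymmetricAlgebra.ι ℂ _ z, SymmetricAlgebra.ι_mem_positivePart z, fun h => hz0 ?_,
    fun g => ?_⟩
  · exact SymmetricAlgebra.ι_injective (h.trans (map_zero _).symm)
  · rw [SymmetricAlgebra.rep_ι, ← map_smul]
    exact congrArg _ (hz g)

end GradedModule

/-! ### The maps `ι_T` are embeddings, distinct for distinct tableaux -/

namespace RectTableau

variable {a b : ℕ} {A B : Type*} [AddCommGroup A] [Module ℂ A] [AddCommGroup B] [Module ℂ B]

/-- Contraction with a linear form on `B` maps `C_k` into `A_m` if the boxes of `T` with numbers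
at most `k` lie in the first `m` rows. -/
theorem rid_lTensor_mem (T : RectTableau a b) {F : CompleteFlag a A} {F' : CompleteFlag b B}
    {k : Fin (a * b + 1)} {m : Fin a}
    (hk : ∀ i j, (T.entry (i, j)).castSucc < k → i ≤ m) (φ : Module.Dual ℂ B)
    {z : A ⊗[ℂ] B} (hz : z ∈ T.iotaSpace F F' k) :
    TensorProduct.rid ℂ A (φ.lTensor A z) ∈ F.space m.succ := by
  have h : T.iotaSpace F F' k ≤ (F.space m.succ).comap
      ((TensorProduct.rid ℂ A).toLinearMap ∘ₗ φ.lTensor A) := by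
    refine Submodule.span_le.mpr ?_
    rintro _ ⟨i, j, hij, x, hx, y, hy, rfl⟩
    simp only [SetLike.mem_coe, Submodule.mem_comap, LinearMap.comp_apply, LinearMap.lTensor_tmul,
      LinearEquiv.coe_coe, TensorProduct.rid_tmul]
    exact Submodule.smul_mem _ _ (F.mono (Fin.succ_le_succ_iff.mpr (hk i j hij)) hx)
  exact h hz

/-- Contraction with a linear form on `A` maps `C_k` into `B_m` if the boxes of `T` with numbers
at most `k` lie in the first `m` columns. -/
theorem lid_rTensor_mem (T : RectTableau a b) {F : CompleteFlag a A} {F' : CompleteFlag b B}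
    {k : Fin (a * b + 1)} {m : Fin b}
    (hk : ∀ i j, (T.entry (i, j)).castSucc < k → j ≤ m) (φ : Module.Dual ℂ A)
    {z : A ⊗[ℂ] B} (hz : z ∈ T.iotaSpace F F' k) :
    TensorProduct.lid ℂ B (φ.rTensor B z) ∈ F'.space m.succ := by
  have h : T.iotaSpace F F' k ≤ (F'.space m.succ).comap
      ((TensorProduct.lid ℂ B).toLinearMap ∘ₗ φ.rTensor B) := by
    refine Submodule.span_le.mpr ?_
    rintro _ ⟨i, j, hij, x, hx, y, hy, rfl⟩
    simp only [SetLike.mem_coe, Submodule.mem_comap, LinearMap.comp_apply, LinearMap.rTensor_tmul,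
      LinearEquiv.coe_coe, TensorProduct.lid_tmul]
    exact Submodule.smul_mem _ _ (F'.mono (Fin.succ_le_succ_iff.mpr (hk i j hij)) hy)
  exact h hz

/-- When the first box of row `m` enters, no later row has started. This supplies the hypothesis of
`rid_lTensor_mem`. -/
theorem row_le_of_lt_succ (T : RectTableau a b) (hb : 0 < b) (m : Fin a) (i : Fin a) (j : Fin b)
    (h : (T.entry (i, j)).castSucc < (T.entry (m, ⟨0, hb⟩)).succ) : i ≤ m := by
  have h1 : T.entry (i, ⟨0, hb⟩) ≤ T.entry (m, ⟨0, hb⟩) :=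
    (T.entry_le le_rfl (Fin.mk_le_mk.mpr (Nat.zero_le _))).trans (Fin.castSucc_lt_succ_iff.mp h)
  exact (T.col_strict _).le_iff_le.mp h1

theorem col_le_of_lt_succ (T : RectTableau a b) (ha : 0 < a) (m : Fin b) (i : Fin a) (j : Fin b)
    (h : (T.entry (i, j)).castSucc < (T.entry (⟨0, ha⟩, m)).succ) : j ≤ m := by
  have h1 : T.entry (⟨0, ha⟩, j) ≤ T.entry (⟨0, ha⟩, m) :=
    (T.entry_le (Fin.mk_le_mk.mpr (Nat.zero_le _)) le_rfl).trans (Fin.castSucc_lt_succ_iff.mp h)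
  exact (T.row_strict _).le_iff_le.mp h1

end RectTableau

namespace CompleteFlag

variable {n : ℕ} {V : Type*} [AddCommGroup V] [Module ℂ V]

/-- The first line of a flag contains a vector on which some linear form takes the value `1`. -/
theorem exists_mem_dual_eq_one (F : CompleteFlag n V) (hn : 0 < n) :
    ∃ x ∈ F.space (Fin.succ ⟨0, hn⟩), ∃ φ : Module.Dual ℂ V, φ x = 1 := by
  obtain ⟨u, hu⟩ := F.exists_isAdapted
  refine ⟨u ⟨0, hn⟩, ?_, u.coord ⟨0, hn⟩, by simp⟩
  rw [hu]
  exact u.self_mem_flag Fin.castSucc_lt_succ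

theorem eq_of_forall_succ_le {F G : CompleteFlag n V}
    (h : ∀ i : Fin n, F.space i.succ ≤ G.space i.succ) :
    F = G := by
  ext i : 2
  have := F.finiteDimensional
  refine Submodule.eq_of_le_of_finrank_eq ?_ (by rw [F.finrank_space, G.finrank_space])
  refine Fin.cases ?_ (fun i => h i) i
  rw [F.space_zero]
  exact bot_le

theorem mem_stabEnd_of_succ {F : CompleteFlag n V} {X : Module.End ℂ V}
    (h : ∀ i : Fin n, ∀ x ∈ F.space i.succ, X x ∈ F.space i.succ) : X ∈ F.stabEnd := by
  intro i
  refine Fin.cases ?_ (fun i => h i) i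
  rw [F.space_zero]
  exact bot_le

theorem exists_smul_eq (F G : CompleteFlag n V) : ∃ g : V ≃ₗ[ℂ] V, g • F = G := by
  obtain ⟨u, hu⟩ := F.exists_isAdapted
  obtain ⟨v, hv⟩ := G.exists_isAdapted
  refine ⟨u.equiv v (Equiv.refl _), ?_⟩
  ext i : 2
  have := F.finiteDimensional
  rw [smul_space]
  refine Submodule.eq_of_le_of_finrank_eq ?_
    (by rw [LinearEquiv.finrank_map_eq, F.finrank_space, G.finrank_space])
  rw [hu, Submodule.map_le_iff_le_comap, Module.Basis.flag_le_iff]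
  intro j hj
  rw [Submodule.mem_comap, LinearEquiv.coe_coe, Module.Basis.equiv_apply, hv]
  exact v.self_mem_flag hj

end CompleteFlag

namespace RectTableau

variable {a b : ℕ} {A B : Type*} [AddCommGroup A] [Module ℂ A] [AddCommGroup B] [Module ℂ B]

theorem iota_toFun_space (T : RectTableau a b) (y : CompleteFlag a A × CompleteFlag b B)
    (k : Fin (a * b + 1)) : ((T.iota A B).toFun y).space k = T.iotaSpace y.1 y.2 k := rfl

theorem tmul_mem_iotaSpace (T : RectTableau a b) {F : CompleteFlag a A} {F' : CompleteFlag b B}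
    {k : Fin (a * b + 1)} {i : Fin a} {j : Fin b} (hk : (T.entry (i, j)).castSucc < k)
    {x : A} (hx : x ∈ F.space i.succ) {y : B} (hy : y ∈ F'.space j.succ) :
    x ⊗ₜ[ℂ] y ∈ T.iotaSpace F F' k :=
  Submodule.subset_span ⟨i, j, hk, x, hx, y, hy, rfl⟩

/-- For `x ∈ A_i` and `w` in the first line of `B_•`, the tensor `x ⊗ w` lies in the step of the
image flag indexed by the box `(i, 1)`. Contraction with a form `φ`, `φ(w) = 1`, sends that step
into the `i`-th space of any flag with the same image and returns `x`. The argument for `B` is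
symmetric. -/
theorem iota_injective (T : RectTableau a b) (ha : 0 < a) (hb : 0 < b) :
    Function.Injective (T.iota A B).toFun := by
  rintro ⟨F, F'⟩ ⟨G, G'⟩ h
  have hk : ∀ k, T.iotaSpace F F' k = T.iotaSpace G G' k := fun k =>
    congrFun (congrArg CompleteFlag.space h) k
  refine Prod.ext ?_ ?_
  · refine CompleteFlag.eq_of_forall_succ_le fun i x hx => ?_
    obtain ⟨y, hy, φ, hφ⟩ := F'.exists_mem_dual_eq_one hb
    have h1 : x ⊗ₜ[ℂ] y ∈ T.iotaSpace F F' (T.entry (i, ⟨0, hb⟩)).succ :=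
      T.tmul_mem_iotaSpace Fin.castSucc_lt_succ hx hy
    rw [hk] at h1
    simpa [hφ] using T.rid_lTensor_mem (T.row_le_of_lt_succ hb i) φ h1
  · refine CompleteFlag.eq_of_forall_succ_le fun j y hy => ?_
    obtain ⟨x, hx, φ, hφ⟩ := F.exists_mem_dual_eq_one ha
    have h1 : x ⊗ₜ[ℂ] y ∈ T.iotaSpace F F' (T.entry (⟨0, ha⟩, j)).succ :=
      T.tmul_mem_iotaSpace Fin.castSucc_lt_succ hx hy
    rw [hk] at h1
    simpa [hφ] using T.lid_rTensor_mem (T.col_le_of_lt_succ ha j) φ h1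

theorem iota_differential_injective (T : RectTableau a b) (ha : 0 < a) (hb : 0 < b)
    (y : CompleteFlag a A × CompleteFlag b B) :
    Function.Injective ((T.iota A B).differential y) := by
  rw [← LinearMap.ker_eq_bot, LinearMap.ker_eq_bot']
  rintro ⟨X, Y⟩ hXY
  induction X using Submodule.Quotient.induction_on with | H X => ?_
  induction Y using Submodule.Quotient.induction_on with | H Y => ?_
  change Submodule.Quotient.mk (LinearMap.rTensorHom B X + LinearMap.lTensorHom A Y) = _ at hXY
  rw [Submodule.Quotient.mk_eq_zero] at hXY
  refine Prod.ext ((Submodule.Quotient.mk_eq_zero _).mpr ?_)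
    ((Submodule.Quotient.mk_eq_zero _).mpr ?_)
  · refine CompleteFlag.mem_stabEnd_of_succ fun i x hx => ?_
    obtain ⟨w, hw, φ, hφ⟩ := y.2.exists_mem_dual_eq_one hb
    have h1 := T.rid_lTensor_mem (T.row_le_of_lt_succ hb i) φ
      (hXY (T.entry (i, ⟨0, hb⟩)).succ (T.tmul_mem_iotaSpace Fin.castSucc_lt_succ hx hw))
    -- The contraction is `X x + φ(Y w) • x`; the second term already lies in `A_i`, so `X x` does
    -- too.
    simp [hφ] at h1
    exact (Submodule.add_mem_iff_left _ (Submodule.smul_mem _ _ hx)).mp h1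
  · refine CompleteFlag.mem_stabEnd_of_succ fun j w hw => ?_
    obtain ⟨x, hx, φ, hφ⟩ := y.1.exists_mem_dual_eq_one ha
    have h1 := T.lid_rTensor_mem (T.col_le_of_lt_succ ha j) φ
      (hXY (T.entry (⟨0, ha⟩, j)).succ (T.tmul_mem_iotaSpace Fin.castSucc_lt_succ hx hw))
    simp [hφ] at h1
    exact (Submodule.add_mem_iff_right _ (Submodule.smul_mem _ _ hw)).mp h1

theorem iota_isEmbedding (T : RectTableau a b) (ha : 0 < a) (hb : 0 < b) :
    (T.iota A B).IsEmbedding :=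
  ⟨T.iota_injective ha hb, T.iota_differential_injective ha hb⟩

theorem tmul_mem_iotaSpace_iff (T : RectTableau a b) {F : CompleteFlag a A}
    {F' : CompleteFlag b B} {u : Module.Basis (Fin a) ℂ A} {v : Module.Basis (Fin b) ℂ B}
    (hu : F.IsAdapted u) (hv : F'.IsAdapted v) (k : Fin (a * b + 1)) (i : Fin a) (j : Fin b) :
    u i ⊗ₜ[ℂ] v j ∈ T.iotaSpace F F' k ↔ (T.entry (i, j)).castSucc < k := by
  rw [T.iotaSpace_eq_flag hu hv, ← Module.Basis.self_mem_flag_iff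
    ((u.tensorProduct v).reindex T.entry)]
  simp

theorem iota_inj (u : Module.Basis (Fin a) ℂ A) (v : Module.Basis (Fin b) ℂ B)
    {T T' : RectTableau a b} (h : T.iota A B = T'.iota A B) : T = T' := by
  have hu : (CompleteFlag.ofBasis u).IsAdapted u := fun _ => rfl
  have hv : (CompleteFlag.ofBasis v).IsAdapted v := fun _ => rfl
  have key : ∀ k i j, (T.entry (i, j)).castSucc < k ↔ (T'.entry (i, j)).castSucc < k := by
    intro k i j
    rw [← T.tmul_mem_iotaSpace_iff hu hv, ← T'.tmul_mem_iotaSpace_iff hu hv]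
    have h1 : T.iotaSpace (CompleteFlag.ofBasis u) (CompleteFlag.ofBasis v) k =
        T'.iotaSpace (CompleteFlag.ofBasis u) (CompleteFlag.ofBasis v) k := by
      rw [← T.iota_toFun_space (_, _), h, T'.iota_toFun_space]
    rw [h1]
  refine RectTableau.ext (Equiv.ext fun ⟨i, j⟩ => le_antisymm ?_ ?_)
  · exact Fin.castSucc_lt_succ_iff.mp ((key _ i j).mpr Fin.castSucc_lt_succ)
  · exact Fin.castSucc_lt_succ_iff.mp ((key _ i j).mp Fin.castSucc_lt_succ)

end RectTableau

/-! ### Classification of the equivariant maps -/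

namespace EquivariantFlagMap

variable {a b : ℕ} {A B : Type*} [AddCommGroup A] [Module ℂ A] [AddCommGroup B] [Module ℂ B]

theorem ext_of_apply {ι κ : EquivariantFlagMap a b A B} {y : CompleteFlag a A × CompleteFlag b B}
    (h : ι.toFun y = κ.toFun y) : ι = κ := by
  refine EquivariantFlagMap.ext (funext fun z => ?_)
  obtain ⟨g, hg⟩ := y.1.exists_smul_eq z.1
  obtain ⟨g', hg'⟩ := y.2.exists_smul_eq z.2
  have hz : z = (g • y.1, g' • y.2) := Prod.ext hg.symm hg'.symm
  rw [hz, ι.map_smul, κ.map_smul, h]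

/-- The matrix unit `u_i ↦ u_k` with `k ≤ i` preserves the flag. -/
theorem unit_mem_stabEnd {n : ℕ} {V : Type*} [AddCommGroup V] [Module ℂ V]
    {F : CompleteFlag n V} {u : Module.Basis (Fin n) ℂ V} (hu : F.IsAdapted u) {k i : Fin n}
    (hki : k ≤ i) : (u.coord i).smulRight (u k) ∈ F.stabEnd := by
  intro m
  rw [hu, Module.Basis.flag_le_iff]
  intro j hj
  rw [Submodule.mem_comap, LinearMap.smulRight_apply, Module.Basis.coord_apply,
    Module.Basis.repr_self, Finsupp.single_apply]
  split_ifs with h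
  · rw [one_smul]
    exact u.self_mem_flag (lt_of_le_of_lt (Fin.castSucc_le_castSucc_iff.mpr (h ▸ hki)) hj)
  · rw [zero_smul]
    exact Submodule.zero_mem _

variable (ι : EquivariantFlagMap a b A B) {y : CompleteFlag a A × CompleteFlag b B}
  {u : Module.Basis (Fin a) ℂ A} {v : Module.Basis (Fin b) ℂ B}

theorem tmul_mem_of_le_left (hu : y.1.IsAdapted u) {k : Fin (a * b + 1)} {i i' : Fin a}
    (hi : i' ≤ i) {w : B} (h : u i ⊗ₜ[ℂ] w ∈ (ι.toFun y).space k) :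
    u i' ⊗ₜ[ℂ] w ∈ (ι.toFun y).space k := by
  simpa using ι.rTensor_mem y (unit_mem_stabEnd hu hi) k h

theorem tmul_mem_of_le_right (hv : y.2.IsAdapted v) {k : Fin (a * b + 1)} {j j' : Fin b}
    (hj : j' ≤ j) {x : A} (h : x ⊗ₜ[ℂ] v j ∈ (ι.toFun y).space k) :
    x ⊗ₜ[ℂ] v j' ∈ (ι.toFun y).space k := by
  simpa using ι.lTensor_mem y (unit_mem_stabEnd hv hj) k h

/-- The diagonal matrix units preserve the two flags, so their tensor product, the projector onto
the line of `u_i ⊗ v_j`, preserves `C_k`. Hence `C_k` is spanned by the `u_i ⊗ v_j` that it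
contains. -/
theorem repr_smul_mem (hu : y.1.IsAdapted u) (hv : y.2.IsAdapted v) {k : Fin (a * b + 1)}
    {z : A ⊗[ℂ] B} (hz : z ∈ (ι.toFun y).space k) (i : Fin a) (j : Fin b) :
    (u.tensorProduct v).repr z (i, j) • (u i ⊗ₜ[ℂ] v j) ∈ (ι.toFun y).space k := by
  have h1 := ι.lTensor_mem y (unit_mem_stabEnd hv (le_refl j)) k
    (ι.rTensor_mem y (unit_mem_stabEnd hu (le_refl i)) k hz)
  have h2 : ∀ z : A ⊗[ℂ] B, (u.tensorProduct v).repr z (i, j) • (u i ⊗ₜ[ℂ] v j) =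
      LinearMap.lTensorHom A ((v.coord j).smulRight (v j))
        (LinearMap.rTensorHom B ((u.coord i).smulRight (u i)) z) := by
    intro z
    induction z using TensorProduct.induction_on with
    | zero => simp
    | add z z' h h' => simp only [map_add, Finsupp.add_apply, add_smul, h, h']
    | tmul x w => simp [TensorProduct.smul_tmul', TensorProduct.tmul_smul, smul_smul, mul_comm]
  rw [h2]
  exact h1

theorem exists_tmul_mem_succ (hu : y.1.IsAdapted u) (hv : y.2.IsAdapted v) (m : Fin (a * b)) :
    ∃ p : Fin a × Fin b, u p.1 ⊗ₜ[ℂ] v p.2 ∈ (ι.toFun y).space m.succ ∧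
      u p.1 ⊗ₜ[ℂ] v p.2 ∉ (ι.toFun y).space m.castSucc := by
  by_contra! h
  have := (ι.toFun y).finiteDimensional
  have h1 : (ι.toFun y).space m.succ ≤ (ι.toFun y).space m.castSucc := by
    intro z hz
    rw [← (u.tensorProduct v).sum_repr z]
    refine Submodule.sum_mem _ fun p _ => ?_
    rw [Module.Basis.tensorProduct_apply']
    have h2 := ι.repr_smul_mem hu hv hz p.1 p.2
    by_cases h0 : (u.tensorProduct v).repr z (p.1, p.2) = 0
    · rw [Prod.mk.eta] at h0
      rw [h0, zero_smul]
      exact Submodule.zero_mem _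
    · exact Submodule.smul_mem _ _ (h p ((Submodule.smul_mem_iff _ h0).mp h2))
  have h2 := Submodule.finrank_mono h1
  rw [CompleteFlag.finrank_space, CompleteFlag.finrank_space] at h2
  simp at h2

/-- Every equivariant map is of the form `ι_T`. -/
theorem exists_eq_iota (y : CompleteFlag a A × CompleteFlag b B) :
    ∃ T : RectTableau a b, ι = T.iota A B := by
  obtain ⟨u, hu⟩ := y.1.exists_isAdapted
  obtain ⟨v, hv⟩ := y.2.exists_isAdapted
  choose w hw hw' using ι.exists_tmul_mem_succ hu hv
  have hlt : ∀ m m', m < m' → w m ≠ w m' := fun m m' h he =>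
    hw' m' (he ▸ (ι.toFun y).mono (Fin.succ_le_castSucc_iff.mpr h) (hw m))
  have hinj : Function.Injective w := by
    intro m m' h
    by_contra hne
    rcases lt_or_gt_of_ne hne with h1 | h1
    · exact hlt _ _ h1 h
    · exact hlt _ _ h1 h.symm
  -- The map `w` sends each step to a box appearing there. It is injective because the steps are
  -- nested, hence bijective by counting; its inverse is the numbering sought.
  let e : Fin a × Fin b ≃ Fin (a * b) :=
    (Equiv.ofBijective w ((Fintype.bijective_iff_injective_and_card w).mpr
      ⟨hinj, by simp⟩)).symm
  have he : ∀ p, w (e p) = p := fun p => Equiv.ofBijective_apply_symm_apply w _ p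
  have hmem : ∀ p k, (e p).castSucc < k → u p.1 ⊗ₜ[ℂ] v p.2 ∈ (ι.toFun y).space k := by
    intro p k hk
    have h1 := hw (e p)
    rw [he] at h1
    exact (ι.toFun y).mono (Fin.castSucc_lt_iff_succ_le.mp hk) h1
  have hmem' : ∀ p k, u p.1 ⊗ₜ[ℂ] v p.2 ∈ (ι.toFun y).space k → (e p).castSucc < k := by
    intro p k hk
    by_contra! h
    have h1 := hw' (e p)
    rw [he] at h1
    exact h1 ((ι.toFun y).mono h hk)
  have hle : ∀ i i' j j', i' ≤ i → j' ≤ j → e (i', j') ≤ e (i, j) := fun i i' j j' hi hj =>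
    Fin.castSucc_lt_succ_iff.mp (hmem' (i', j') _ (ι.tmul_mem_of_le_left hu hi
      (ι.tmul_mem_of_le_right hv hj (hmem (i, j) _ Fin.castSucc_lt_succ))))
  let T : RectTableau a b :=
    { entry := e
      row_strict := fun i j' j h => lt_of_le_of_ne (hle i i j j' le_rfl h.le) fun h' => by
        simpa [h.ne] using e.injective h'
      col_strict := fun j i' i h => lt_of_le_of_ne (hle i i' j j h.le le_rfl) fun h' => by
        simpa [h.ne] using e.injective h' }
  -- Agreement at `y` suffices by transitivity, and one inclusion suffices because flags have
  -- prescribed dimensions.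
  refine ⟨T, ext_of_apply (y := y) (Eq.symm ?_)⟩
  refine CompleteFlag.eq_of_forall_succ_le fun m => ?_
  rw [T.iota_toFun_space, T.iotaSpace_eq_span hu hv]
  refine Submodule.span_le.mpr ?_
  rintro _ ⟨i, j, hij, rfl⟩
  exact hmem (i, j) _ hij

end EquivariantFlagMap

/-! ### Unipotent elements and exhaustiveness of the canonical filtration -/

namespace CompleteFlag

variable {n : ℕ} {V : Type*} [AddCommGroup V] [Module ℂ V]

/-- `X` maps `V_m` into `V_{m'}` whenever `m' ≥ m + n - k`. -/
def LowersBy (F : CompleteFlag n V) (k : ℕ) (X : Module.End ℂ V) : Prop :=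
  ∀ m m' : Fin (n + 1), (m : ℕ) + n ≤ m' + k → ∀ x ∈ F.space m, X x ∈ F.space m'

/-- The shift by `n` in `LowersBy` makes this the start of a decreasing filtration of `End(V)`: for
`k = 0` only `m = 0` is constrained, while `k = 2n` forces `X = 0`. -/
theorem lowersBy_zero (F : CompleteFlag n V) (X : Module.End ℂ V) : F.LowersBy 0 X := by
  intro m m' h x hx
  have hm : m = 0 := Fin.ext (by rw [Fin.val_zero]; omega)
  rw [hm, F.space_zero, Submodule.mem_bot] at hx
  rw [hx, map_zero]
  exact Submodule.zero_mem _

theorem LowersBy.eq_zero {F : CompleteFlag n V} {X : Module.End ℂ V}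
    (h : F.LowersBy (n + n) X) : X = 0 := by
  ext x
  have h1 := h (Fin.last n) 0 (by simp) x (by rw [F.space_last]; trivial)
  rwa [F.space_zero, Submodule.mem_bot] at h1

/-- Write `g X g⁻¹ - X = g X (g⁻¹ - 1) + (g - 1) X`. Both `g⁻¹ - 1` and `g - 1` lower the flag by
one step, the first before `X` acts and the second after. -/
theorem LowersBy.adjoint_sub {F : CompleteFlag n V} {k : ℕ} {X : Module.End ℂ V}
    (h : F.LowersBy k X) {g : F.borel} (hg : g ∈ F.unipotent) :
    F.LowersBy (k + 1) (adjoint V g.1 X - X) := by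
  intro m m' hm x hx
  rw [LinearMap.sub_apply, adjoint_apply]
  have e : g.1 (X (g.1.symm x)) - X x =
      g.1 (X (g.1.symm x - x)) + (g.1 (X x) - X x) := by
    rw [map_sub, map_sub]
    abel
  rw [e]
  refine Submodule.add_mem _ (F.apply_mem g _ ?_) ?_
  · induction m using Fin.cases with
    | zero =>
      rw [F.space_zero, Submodule.mem_bot] at hx
      simp [hx]
    | succ m =>
      refine h m.castSucc m' ?_ _ (inv_mem hg m x hx)
      simp at hm ⊢
      omega
  · induction m' using Fin.lastCases with
    | last => rw [F.space_last]; trivial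
    | cast m' =>
      refine hg m' _ (h m m'.succ ?_ x hx)
      simp at hm ⊢
      omega

end CompleteFlag

namespace RectTableau

variable {a b : ℕ} {A B : Type*} [AddCommGroup A] [Module ℂ A] [AddCommGroup B] [Module ℂ B]

theorem tmul_mem_iotaSpace_of_left (T : RectTableau a b) {F : CompleteFlag a A}
    {F' : CompleteFlag b B} {i : Fin a} {j : Fin b} {x : A} (hx : x ∈ F.space i.castSucc) {y : B}
    (hy : y ∈ F'.space j.succ) : x ⊗ₜ[ℂ] y ∈ T.iotaSpace F F' (T.entry (i, j)).castSucc := by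
  obtain ⟨i, hi⟩ := i
  cases i with
  | zero =>
    have h0 : x = 0 := by
      have h1 : x ∈ F.space 0 := hx
      rwa [F.space_zero, Submodule.mem_bot] at h1
    rw [h0, TensorProduct.zero_tmul]
    exact Submodule.zero_mem _
  | succ i =>
    exact T.tmul_mem_iotaSpace (i := ⟨i, by omega⟩) (Fin.castSucc_lt_castSucc_iff.mpr
      (T.col_strict j (Fin.mk_lt_mk.mpr (Nat.lt_succ_self i)))) hx hy

theorem tmul_mem_iotaSpace_of_right (T : RectTableau a b) {F : CompleteFlag a A}
    {F' : CompleteFlag b B} {i : Fin a} {j : Fin b} {x : A} (hx : x ∈ F.space i.succ) {y : B}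
    (hy : y ∈ F'.space j.castSucc) : x ⊗ₜ[ℂ] y ∈ T.iotaSpace F F' (T.entry (i, j)).castSucc := by
  obtain ⟨j, hj⟩ := j
  cases j with
  | zero =>
    have h0 : y = 0 := by
      have h1 : y ∈ F'.space 0 := hy
      rwa [F'.space_zero, Submodule.mem_bot] at h1
    rw [h0, TensorProduct.tmul_zero]
    exact Submodule.zero_mem _
  | succ j =>
    exact T.tmul_mem_iotaSpace (j := ⟨j, by omega⟩) (Fin.castSucc_lt_castSucc_iff.mpr
      (T.row_strict i (Fin.mk_lt_mk.mpr (Nat.lt_succ_self j)))) hx hy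

/-- In `g x ⊗ h w - x ⊗ w = (g x - x) ⊗ h w + x ⊗ (h w - w)` one factor of each term drops a step,
so the term belongs to a box preceding `(i, j)` in its column or row. -/
theorem isotropyHom_mem_unipotent (T : RectTableau a b)
    {y : CompleteFlag a A × CompleteFlag b B} {p : EquivariantFlagMap.isotropy y}
    (hp : p ∈ EquivariantFlagMap.unipotentRadical y) :
    (T.iota A B).isotropyHom y p ∈ ((T.iota A B).toFun y).unipotent := by
  intro m
  change T.iotaSpace y.1 y.2 m.succ ≤ (T.iotaSpace y.1 y.2 m.castSucc).comap
    ((TensorProduct.congr p.1.1 p.1.2).toLinearMap - LinearMap.id)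
  refine Submodule.span_le.mpr ?_
  rintro _ ⟨i, j, hij, x, hx, w, hw, rfl⟩
  simp only [SetLike.mem_coe, Submodule.mem_comap, LinearMap.sub_apply, LinearEquiv.coe_coe,
    TensorProduct.congr_tmul, LinearMap.id_apply]
  have e : p.1.1 x ⊗ₜ[ℂ] p.1.2 w - x ⊗ₜ[ℂ] w =
      (p.1.1 x - x) ⊗ₜ[ℂ] p.1.2 w + x ⊗ₜ[ℂ] (p.1.2 w - w) := by
    rw [TensorProduct.sub_tmul, TensorProduct.tmul_sub]
    abel
  rw [e]
  have hle : T.iotaSpace y.1 y.2 (T.entry (i, j)).castSucc ≤ T.iotaSpace y.1 y.2 m.castSucc :=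
    ((T.iota A B).toFun y).mono
      (Fin.castSucc_le_castSucc_iff.mpr (Fin.castSucc_lt_succ_iff.mp hij))
  exact Submodule.add_mem _
    (hle (T.tmul_mem_iotaSpace_of_left (hp.1 i x hx) (y.2.apply_mem ⟨p.1.2, p.2.2⟩ _ hw)))
    (hle (T.tmul_mem_iotaSpace_of_right hx (hp.2 j w hw)))

end RectTableau

/-! ### The conormal module inside `End(A ⊗ B)^*` -/

namespace EquivariantFlagMap

variable {a b : ℕ} {A B : Type*} [AddCommGroup A] [Module ℂ A] [AddCommGroup B] [Module ℂ B]

/-- The projection of `End(A ⊗ B)` onto the fibre of the normal bundle. -/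
def toNormal (ι : EquivariantFlagMap a b A B) (y : CompleteFlag a A × CompleteFlag b B) :
    Module.End ℂ (A ⊗[ℂ] B) →ₗ[ℂ] ι.Normal y :=
  (LinearMap.range (ι.differential y)).mkQ ∘ₗ (ι.toFun y).stabEnd.mkQ

theorem toNormal_surjective (ι : EquivariantFlagMap a b A B)
    (y : CompleteFlag a A × CompleteFlag b B) : Function.Surjective (ι.toNormal y) :=
  (Submodule.mkQ_surjective _).comp (Submodule.mkQ_surjective _)

theorem conormalRep_toNormal (ι : EquivariantFlagMap a b A B)
    (y : CompleteFlag a A × CompleteFlag b B) (p : isotropy y) (ξ : Module.Dual ℂ (ι.Normal y))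
    (X : Module.End ℂ (A ⊗[ℂ] B)) :
    ι.conormalRep y p ξ (ι.toNormal y X) =
      ξ (ι.toNormal y (CompleteFlag.adjoint _ (ι.isotropyHom y p⁻¹).1 X)) := rfl

/-- The `P`-module `End(A ⊗ B)^*`. -/
def dualEndRep (ι : EquivariantFlagMap a b A B) (y : CompleteFlag a A × CompleteFlag b B) :
    Representation ℂ (isotropy y) (Module.Dual ℂ (Module.End ℂ (A ⊗[ℂ] B))) :=
  Representation.dual ((CompleteFlag.adjoint (A ⊗[ℂ] B)).comp
    ((ι.toFun y).borel.subtype.comp (ι.isotropyHom y)))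

theorem dualEndRep_apply (ι : EquivariantFlagMap a b A B)
    (y : CompleteFlag a A × CompleteFlag b B) (p : isotropy y)
    (Φ : Module.Dual ℂ (Module.End ℂ (A ⊗[ℂ] B))) (X : Module.End ℂ (A ⊗[ℂ] B)) :
    ι.dualEndRep y p Φ X = Φ (CompleteFlag.adjoint _ (ι.isotropyHom y p⁻¹).1 X) := rfl

theorem dualMap_toNormal_injective (ι : EquivariantFlagMap a b A B)
    (y : CompleteFlag a A × CompleteFlag b B) : Function.Injective (ι.toNormal y).dualMap :=
  LinearMap.dualMap_injective_of_surjective (ι.toNormal_surjective y)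

theorem exists_dualMap_toNormal_eq (ι : EquivariantFlagMap a b A B)
    (y : CompleteFlag a A × CompleteFlag b B) (Φ : Module.Dual ℂ (Module.End ℂ (A ⊗[ℂ] B)))
    (h1 : ∀ X ∈ (ι.toFun y).stabEnd, Φ X = 0)
    (h2 : ∀ X, Φ (LinearMap.rTensorHom B X) = 0) (h3 : ∀ Y, Φ (LinearMap.lTensorHom A Y) = 0) :
    ∃ ξ, (ι.toNormal y).dualMap ξ = Φ := by
  refine ⟨Submodule.liftQ _ (Submodule.liftQ _ Φ h1) ?_, rfl⟩
  rintro _ ⟨⟨X, Y⟩, rfl⟩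
  induction X using Submodule.Quotient.induction_on with | H X => ?_
  induction Y using Submodule.Quotient.induction_on with | H Y => ?_
  change Φ (LinearMap.rTensorHom B X + LinearMap.lTensorHom A Y) = 0
  rw [map_add, h2, h3, add_zero]

/-- The canonical filtration of the conormal module is exhaustive. -/
theorem filtration_conormalRep_eq_top (T : RectTableau a b)
    (y : CompleteFlag a A × CompleteFlag b B) :
    GradedModule.filtration ((T.iota A B).conormalRep y) (unipotentRadical y)
      (a * b + a * b) = ⊤ := by
  -- Dual form of the lowering filtration: forms killing the endomorphisms with `LowersBy k` lie in
  -- the `k`-th step, since `p ξ - ξ` evaluates `ξ` on `Ad(p⁻¹) X - X`, which lowers by one more. At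
  -- `k = 2ab` the condition is vacuous.
  have key : ∀ (k : ℕ) (ξ : Module.Dual ℂ ((T.iota A B).Normal y)),
      (∀ X, ((T.iota A B).toFun y).LowersBy k X → ξ ((T.iota A B).toNormal y X) = 0) →
      ξ ∈ GradedModule.filtration ((T.iota A B).conormalRep y) (unipotentRadical y) k := by
    intro k
    induction k with
    | zero =>
      intro ξ h
      refine (Submodule.mem_bot ℂ).mpr (LinearMap.ext fun z => ?_)
      obtain ⟨X, rfl⟩ := (T.iota A B).toNormal_surjective y z
      exact h X (CompleteFlag.lowersBy_zero _ X)
    | succ k ih =>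
      intro ξ h p hp
      refine ih _ fun X hX => ?_
      rw [LinearMap.sub_apply, conormalRep_toNormal, ← map_sub, ← map_sub]
      exact h _ (hX.adjoint_sub (T.isotropyHom_mem_unipotent (inv_mem hp)))
  refine eq_top_iff.mpr fun ξ _ => key _ ξ fun X hX => ?_
  rw [hX.eq_zero, map_zero, map_zero]

/-! ### Weights -/

theorem weightChar_one (w : WeightLattice a b) : weightChar w 1 = 1 := by
  simp [weightChar]

theorem weightChar_mul (w : WeightLattice a b) (t s : (Fin a → ℂˣ) × (Fin b → ℂˣ)) :
    weightChar w (t * s) = weightChar w t * weightChar w s := by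
  simp only [weightChar, Prod.fst_mul, Prod.snd_mul, Pi.mul_apply, mul_zpow,
    Finset.prod_mul_distrib]
  exact mul_mul_mul_comm _ _ _ _

theorem weightChar_add (w w' : WeightLattice a b) (t : (Fin a → ℂˣ) × (Fin b → ℂˣ)) :
    weightChar (w + w') t = weightChar w t * weightChar w' t := by
  simp only [weightChar, Prod.fst_add, Prod.snd_add, Pi.add_apply, zpow_add,
    Finset.prod_mul_distrib]
  exact mul_mul_mul_comm _ _ _ _

/-- The character of weight `w`, as a homomorphism to `ℂ`. -/
def weightHom (w : WeightLattice a b) : ((Fin a → ℂˣ) × (Fin b → ℂˣ)) →* ℂ where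
  toFun t := weightChar w t
  map_one' := by rw [weightChar_one, Units.val_one]
  map_mul' t s := by rw [weightChar_mul, Units.val_mul]

theorem weightHom_apply (w : WeightLattice a b) (t : (Fin a → ℂˣ) × (Fin b → ℂˣ)) :
    weightHom w t = weightChar w t := rfl

theorem weightHom_add (w w' : WeightLattice a b) :
    weightHom (w + w') = weightHom w * weightHom w' :=
  MonoidHom.ext fun t => by
    rw [MonoidHom.mul_apply, weightHom_apply, weightChar_add, Units.val_mul]
    rfl

theorem prod_mulSingle_zpow {n : ℕ} (w : Fin n → ℤ) (i : Fin n) (c : ℂˣ) :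
    ∏ k, (Pi.mulSingle i c : Fin n → ℂˣ) k ^ w k = c ^ w i := by
  rw [Finset.prod_eq_single i (fun k _ hk => by rw [Pi.mulSingle_eq_of_ne hk, one_zpow])
    (fun h => absurd (Finset.mem_univ i) h), Pi.mulSingle_eq_same]

theorem prod_zpow_single {n : ℕ} (t : Fin n → ℂˣ) (i : Fin n) :
    ∏ k, t k ^ (Pi.single i 1 : Fin n → ℤ) k = t i := by
  rw [Finset.prod_eq_single i (fun k _ hk => by rw [Pi.single_eq_of_ne hk, zpow_zero])
    (fun h => absurd (Finset.mem_univ i) h), Pi.single_eq_same, zpow_one]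

/-- Evaluating at the torus element with a single eigenvalue `2` and all others `1` gives `2` to the
corresponding coordinate of the weight; absolute values recover the exponent. -/
theorem weightHom_injective : Function.Injective (weightHom (a := a) (b := b)) := by
  intro w w' h
  have h2 : (2 : ℂ) ≠ 0 := two_ne_zero
  have hinj : ∀ m n : ℤ, (2 : ℂ) ^ m = 2 ^ n → m = n := by
    intro m n hmn
    have h3 := congrArg (‖·‖) hmn
    simp only [norm_zpow, Complex.norm_ofNat] at h3
    exact zpow_right_injective₀ two_pos (by norm_num) h3
  refine Prod.ext (funext fun i => hinj _ _ ?_) (funext fun j => hinj _ _ ?_)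
  · simpa [weightHom_apply, weightChar, prod_mulSingle_zpow] using
      DFunLike.congr_fun h (Pi.mulSingle i (Units.mk0 2 h2), 1)
  · simpa [weightHom_apply, weightChar, prod_mulSingle_zpow] using
      DFunLike.congr_fun h (1, Pi.mulSingle j (Units.mk0 2 h2))

/-- The weight `e_k + f_l - e_i - f_j`, for `p = (i, j)` and `q = (k, l)`. -/
def coeffWeight (p q : Fin a × Fin b) : WeightLattice a b :=
  (Pi.single q.1 1 - Pi.single p.1 1, Pi.single q.2 1 - Pi.single p.2 1)

theorem weightChar_coeffWeight (p q : Fin a × Fin b) (t : (Fin a → ℂˣ) × (Fin b → ℂˣ)) :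
    weightChar (coeffWeight p q) t = (t.1 p.1 * t.2 p.2)⁻¹ * (t.1 q.1 * t.2 q.2) := by
  simp only [weightChar, coeffWeight, Pi.sub_apply, zpow_sub, Finset.prod_mul_distrib,
    Finset.prod_inv_distrib, prod_zpow_single]
  rw [mul_mul_mul_comm, mul_comm, mul_inv]

/-- The matrix coefficients on `End(A ⊗ B)`. -/
def coeff (u : Module.Basis (Fin a) ℂ A) (v : Module.Basis (Fin b) ℂ B) (p q : Fin a × Fin b) :
    Module.Dual ℂ (Module.End ℂ (A ⊗[ℂ] B)) :=
  (u.tensorProduct v).coord p ∘ₗ LinearMap.applyₗ (u.tensorProduct v q)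

theorem coeff_apply (u : Module.Basis (Fin a) ℂ A) (v : Module.Basis (Fin b) ℂ B)
    (p q : Fin a × Fin b) (X : Module.End ℂ (A ⊗[ℂ] B)) :
    coeff u v p q X = (u.tensorProduct v).repr (X (u.tensorProduct v q)) p := rfl

theorem repr_apply_of_diagonal {κ V : Type*} [AddCommGroup V] [Module ℂ V]
    (e : Module.Basis κ ℂ V) {D : Module.End ℂ V} {d : κ → ℂ} (hD : ∀ q, D (e q) = d q • e q)
    (z : V) (p : κ) : e.repr (D z) p = d p * e.repr z p := by
  classical
  have h : e.coord p ∘ₗ D = d p • e.coord p := e.ext fun q => by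
    simp only [LinearMap.comp_apply, hD, _root_.map_smul, LinearMap.smul_apply, Module.Basis.coord_apply,
      Module.Basis.repr_self, Finsupp.single_apply, smul_eq_mul]
    split_ifs with hq
    · rw [hq]
    · simp
  exact LinearMap.congr_fun h z

theorem congr_diag_tensorProduct (u : Module.Basis (Fin a) ℂ A) (v : Module.Basis (Fin b) ℂ B)
    (t : (Fin a → ℂˣ) × (Fin b → ℂˣ)) (q : Fin a × Fin b) :
    TensorProduct.congr (diag u t.1) (diag v t.2) (u.tensorProduct v q) =
      ((t.1 q.1 * t.2 q.2 : ℂˣ) : ℂ) • u.tensorProduct v q := by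
  rw [Module.Basis.tensorProduct_apply', TensorProduct.congr_tmul, diag_apply, diag_apply,
    TensorProduct.smul_tmul_smul, Units.val_mul]

/-- The dual action of `t` evaluates the form on `t⁻¹ X t`, whose `(p, q)` entry is that of `X`
divided by the eigenvalue at `p` and multiplied by the eigenvalue at `q`. -/
theorem coeff_mem_charSpace (ι : EquivariantFlagMap a b A B)
    {y : CompleteFlag a A × CompleteFlag b B}
    {u : Module.Basis (Fin a) ℂ A} {v : Module.Basis (Fin b) ℂ B} (hu : y.1.IsAdapted u)
    (hv : y.2.IsAdapted v) (p q : Fin a × Fin b) :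
    coeff u v p q ∈ Representation.charSpace ((ι.dualEndRep y).comp (levi hu hv))
      (weightHom (coeffWeight p q)) := by
  intro t
  refine LinearMap.ext fun X => ?_
  rw [MonoidHom.comp_apply, dualEndRep_apply, ← map_inv, coeff_apply, CompleteFlag.adjoint_apply]
  set g : A ⊗[ℂ] B ≃ₗ[ℂ] A ⊗[ℂ] B := TensorProduct.congr (diag u t⁻¹.1) (diag v t⁻¹.2)
  have hg : ∀ q, g (u.tensorProduct v q) = ((t⁻¹.1 q.1 * t⁻¹.2 q.2 : ℂˣ) : ℂ) •
      u.tensorProduct v q := congr_diag_tensorProduct u v t⁻¹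
  have hs : g.symm (u.tensorProduct v q) = ((t.1 q.1 * t.2 q.2 : ℂˣ) : ℂ) •
      u.tensorProduct v q := by
    rw [LinearEquiv.symm_apply_eq, _root_.map_smul, hg, smul_smul, ← Units.val_mul]
    simp [mul_mul_mul_comm]
  change (u.tensorProduct v).repr (g (X (g.symm (u.tensorProduct v q)))) p = _
  have hr : (u.tensorProduct v).repr (g (X (u.tensorProduct v q))) p =
      ((t⁻¹.1 p.1 * t⁻¹.2 p.2 : ℂˣ) : ℂ) * coeff u v p q X :=
    repr_apply_of_diagonal (u.tensorProduct v) (D := g.toLinearMap) hg _ p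
  rw [hs, _root_.map_smul, _root_.map_smul, _root_.map_smul, Finsupp.smul_apply, hr,
    LinearMap.smul_apply, weightHom_apply, weightChar_coeffWeight, smul_eq_mul, smul_eq_mul,
    Units.val_mul (_⁻¹), ← mul_assoc, mul_comm ((t.1 q.1 * t.2 q.2 : ℂˣ) : ℂ), Prod.fst_inv,
    Prod.snd_inv, Pi.inv_apply, Pi.inv_apply, ← mul_inv]

theorem coeff_rTensorHom (u : Module.Basis (Fin a) ℂ A) (v : Module.Basis (Fin b) ℂ B)
    (p q : Fin a × Fin b) (X : Module.End ℂ A) :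
    coeff u v p q (LinearMap.rTensorHom B X) =
      u.repr (X (u q.1)) p.1 * if q.2 = p.2 then 1 else 0 := by
  obtain ⟨p₁, p₂⟩ := p
  rw [coeff_apply, Module.Basis.tensorProduct_apply']
  simp [Module.Basis.tensorProduct_repr_tmul_apply, Finsupp.single_apply]

theorem coeff_lTensorHom (u : Module.Basis (Fin a) ℂ A) (v : Module.Basis (Fin b) ℂ B)
    (p q : Fin a × Fin b) (Y : Module.End ℂ B) :
    coeff u v p q (LinearMap.lTensorHom A Y) =
      (if q.1 = p.1 then 1 else 0) * v.repr (Y (v q.2)) p.2 := by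
  obtain ⟨p₁, p₂⟩ := p
  rw [coeff_apply, Module.Basis.tensorProduct_apply']
  simp [Module.Basis.tensorProduct_repr_tmul_apply, Finsupp.single_apply]

/-- The matrix unit `e_q ↦ e_p` of `End(A ⊗ B)`. -/
def tensorUnit (u : Module.Basis (Fin a) ℂ A) (v : Module.Basis (Fin b) ℂ B)
    (p q : Fin a × Fin b) : Module.End ℂ (A ⊗[ℂ] B) :=
  ((u.tensorProduct v).coord q).smulRight (u.tensorProduct v p)

theorem coeff_tensorUnit (u : Module.Basis (Fin a) ℂ A) (v : Module.Basis (Fin b) ℂ B)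
    (p q p' q' : Fin a × Fin b) :
    coeff u v p' q' (tensorUnit u v p q) = if p = p' ∧ q' = q then 1 else 0 := by
  simp only [coeff_apply, tensorUnit, LinearMap.smulRight_apply, Module.Basis.coord_apply,
    Module.Basis.repr_self, _root_.map_smul, Finsupp.smul_apply, Finsupp.single_apply, smul_eq_mul]
  split_ifs <;> simp_all

theorem sum_coeff_smul_tensorUnit (u : Module.Basis (Fin a) ℂ A) (v : Module.Basis (Fin b) ℂ B)
    (X : Module.End ℂ (A ⊗[ℂ] B)) : X = ∑ q, ∑ p, coeff u v p q X • tensorUnit u v p q := by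
  refine (u.tensorProduct v).ext fun r => ?_
  simp only [LinearMap.sum_apply, LinearMap.smul_apply, tensorUnit, LinearMap.smulRight_apply,
    Module.Basis.coord_apply, Module.Basis.repr_self, Finsupp.single_apply, ite_smul, one_smul,
    zero_smul, smul_ite, smul_zero]
  simp only [Finset.sum_ite_irrel, Finset.sum_const_zero, Finset.sum_ite_eq, Finset.mem_univ,
    if_true, coeff_apply]
  exact ((u.tensorProduct v).sum_repr _).symm

theorem iota_isAdapted (T : RectTableau a b) {y : CompleteFlag a A × CompleteFlag b B}
    {u : Module.Basis (Fin a) ℂ A} {v : Module.Basis (Fin b) ℂ B} (hu : y.1.IsAdapted u)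
    (hv : y.2.IsAdapted v) :
    ((T.iota A B).toFun y).IsAdapted ((u.tensorProduct v).reindex T.entry) :=
  fun k => congrFun (T.iotaSpace_eq_flag hu hv) k

theorem tensorUnit_mem_stabEnd (T : RectTableau a b) {y : CompleteFlag a A × CompleteFlag b B}
    {u : Module.Basis (Fin a) ℂ A} {v : Module.Basis (Fin b) ℂ B} (hu : y.1.IsAdapted u)
    (hv : y.2.IsAdapted v) {p q : Fin a × Fin b} (h : T.entry p ≤ T.entry q) :
    tensorUnit u v p q ∈ ((T.iota A B).toFun y).stabEnd := by
  have h1 := unit_mem_stabEnd (iota_isAdapted T hu hv) h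
  have h2 : ((u.tensorProduct v).reindex T.entry).coord (T.entry q) =
      (u.tensorProduct v).coord q := by
    ext; simp
  rwa [Module.Basis.reindex_apply, Equiv.symm_apply_apply, h2] at h1

theorem coeff_eq_zero_of_mem_stabEnd (T : RectTableau a b)
    {y : CompleteFlag a A × CompleteFlag b B}
    {u : Module.Basis (Fin a) ℂ A} {v : Module.Basis (Fin b) ℂ B} (hu : y.1.IsAdapted u)
    (hv : y.2.IsAdapted v) {p q : Fin a × Fin b} (h : T.entry q < T.entry p)
    {X : Module.End ℂ (A ⊗[ℂ] B)} (hX : X ∈ ((T.iota A B).toFun y).stabEnd) :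
    coeff u v p q X = 0 := by
  have hC := iota_isAdapted T hu hv
  have h1 : u.tensorProduct v q ∈ ((T.iota A B).toFun y).space (T.entry q).succ := by
    rw [hC]
    have := ((u.tensorProduct v).reindex T.entry).self_mem_flag
      (Fin.castSucc_lt_succ (i := T.entry q))
    simpa using this
  have h2 := hX _ h1
  rw [Submodule.mem_comap, hC] at h2
  have h3 := ((u.tensorProduct v).reindex T.entry).flag_le_ker_coord
    (Fin.succ_le_castSucc_iff.mpr h) h2
  rw [LinearMap.mem_ker, Module.Basis.coord_apply, Module.Basis.repr_reindex_apply,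
    Equiv.symm_apply_apply] at h3
  exact h3

end EquivariantFlagMap

/-! ### Half spaces and additivity -/

namespace EquivariantFlagMap

variable {a b : ℕ} {A B : Type*} [AddCommGroup A] [Module ℂ A] [AddCommGroup B] [Module ℂ B]

/-- The characters on which `ℓ` is positive. -/
def positiveChars (ℓ : WeightLattice a b →+ ℝ) : Set (((Fin a → ℂˣ) × (Fin b → ℂˣ)) →* ℂ) :=
  {χ | ∃ w, 0 < ℓ w ∧ weightHom w = χ}

theorem mul_mem_positiveChars (ℓ : WeightLattice a b →+ ℝ) :
    ∀ χ ∈ positiveChars ℓ, ∀ ψ ∈ positiveChars ℓ, χ * ψ ∈ positiveChars ℓ := by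
  rintro _ ⟨w, hw, rfl⟩ _ ⟨w', hw', rfl⟩
  exact ⟨w + w', by rw [map_add]; exact add_pos hw hw', weightHom_add w w'⟩

theorem weightHom_mem_positiveChars {ℓ : WeightLattice a b →+ ℝ} {w : WeightLattice a b} :
    weightHom w ∈ positiveChars ℓ ↔ 0 < ℓ w :=
  ⟨fun ⟨_, hw, h⟩ => weightHom_injective h ▸ hw, fun h => ⟨w, h, rfl⟩⟩

section Graded

variable {P M : Type*} [Group P] [AddCommGroup M] [Module ℂ M]
  (ρ : Representation ℂ P M) (U : Subgroup P) [U.Normal]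
  (f : (Fin a → ℂˣ) × (Fin b → ℂˣ) →* P)

theorem pos_of_mem_weights (ℓ : WeightLattice a b →+ ℝ)
    (h : ∀ x, x ∈ Representation.charSpan (ρ.comp f) (positiveChars ℓ)) {w : WeightLattice a b}
    (hw : w ∈ weights ((SymmetricAlgebra.rep (GradedModule.grRep ρ U)).comp f)
      (SymmetricAlgebra.positivePart (GradedModule.Gr ρ U))) : 0 < ℓ w := by
  obtain ⟨z, hz, hz0, hzw⟩ := hw
  exact weightHom_mem_positiveChars.mp (GradedModule.mem_of_mem_positivePart ρ U f
    (mul_mem_positiveChars ℓ) h hz hz0 hzw)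

theorem mem_weights_of_mem_charSpace {n : ℕ} (hn : GradedModule.filtration ρ U n = ⊤)
    {w : WeightLattice a b} {x : M} (hx : x ∈ Representation.charSpace (ρ.comp f) (weightHom w))
    (h0 : x ≠ 0) :
    w ∈ weights ((SymmetricAlgebra.rep (GradedModule.grRep ρ U)).comp f)
      (SymmetricAlgebra.positivePart (GradedModule.Gr ρ U)) :=
  GradedModule.exists_mem_positivePart ρ U f hn hx h0

end Graded

variable (T : RectTableau a b) {y : CompleteFlag a A × CompleteFlag b B}
  {u : Module.Basis (Fin a) ℂ A} {v : Module.Basis (Fin b) ℂ B}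

/-- The conormal module is spanned by weight vectors of weights `e_k + f_l - e_i - f_j` with
`T(k,l) < T(i,j)`. -/
theorem conormalRep_mem_charSpan (hu : y.1.IsAdapted u) (hv : y.2.IsAdapted v)
    {K : Set (((Fin a → ℂˣ) × (Fin b → ℂˣ)) →* ℂ)}
    (hK : ∀ p q, T.entry q < T.entry p → weightHom (coeffWeight p q) ∈ K)
    (ξ : Module.Dual ℂ ((T.iota A B).Normal y)) :
    ξ ∈ Representation.charSpan (((T.iota A B).conormalRep y).comp (levi hu hv)) K := by
  refine Representation.mem_charSpan_of_injective
    (ρ' := ((T.iota A B).dualEndRep y).comp (levi hu hv)) ((T.iota A B).toNormal y).dualMap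
    ((T.iota A B).dualMap_toNormal_injective y) (fun _ _ => rfl) ?_
  -- Expansion of the pulled-back form in matrix coefficients. Terms with `T(p) ≤ T(q)` vanish
  -- because the corresponding matrix unit preserves the flag and so is zero in the normal space.
  -- The remaining coefficients need not lie in `N^*` individually, whence the use of
  -- `mem_charSpan_of_injective`.
  have h : ((T.iota A B).toNormal y).dualMap ξ =
      ∑ q, ∑ p, ξ ((T.iota A B).toNormal y (tensorUnit u v p q)) • coeff u v p q := by
    refine LinearMap.ext fun X => ?_
    conv_lhs => rw [sum_coeff_smul_tensorUnit u v X]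
    simp only [map_sum, _root_.map_smul, LinearMap.sum_apply, LinearMap.smul_apply,
      LinearMap.dualMap_apply, smul_eq_mul, mul_comm]
  rw [h]
  refine Submodule.sum_mem _ fun q _ => Submodule.sum_mem _ fun p _ => ?_
  by_cases hpq : T.entry q < T.entry p
  · exact Submodule.smul_mem _ _ (Representation.mem_charSpan_of_mem (hK p q hpq)
      (coeff_mem_charSpace _ hu hv p q))
  · have h0 : (T.iota A B).toNormal y (tensorUnit u v p q) = 0 := by
      rw [toNormal, LinearMap.comp_apply, Submodule.mkQ_apply _ (tensorUnit u v p q),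
        (Submodule.Quotient.mk_eq_zero _).mpr (tensorUnit_mem_stabEnd T hu hv (not_lt.mp hpq)),
        map_zero]
    rw [h0, map_zero, zero_smul]
    exact Submodule.zero_mem _

theorem isStabilizing_of_forall (ℓ : WeightLattice a b →+ ℝ) (h0 : ℓ ≠ 0)
    (hℓ : ∀ p q, T.entry q < T.entry p → 0 < ℓ (coeffWeight p q)) :
    (T.iota A B).IsStabilizing := by
  intro y u v hu hv
  exact ⟨ℓ, h0, fun w hw => pos_of_mem_weights ((T.iota A B).conormalRep y)
    (unipotentRadical y) (levi hu hv) ℓ (conormalRep_mem_charSpan T hu hv fun p q h =>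
      weightHom_mem_positiveChars.mpr (hℓ p q h)) hw⟩

theorem isStabilizing_of_isAdditive (ha : 0 < a) (h : T.IsAdditive) :
    (T.iota A B).IsStabilizing := by
  obtain ⟨x, z, -, -, hT⟩ := h
  -- Translating all the `x_i` does not change the value on `e_k + f_l - e_i - f_j`, and this
  -- translation makes the value at `e₁` equal to `-1`, so that `ℓ ≠ 0`.
  let c : ℝ := 1 - x ⟨0, ha⟩
  let ℓ : WeightLattice a b →+ ℝ :=
    { toFun := fun w => -(∑ i, (x i + c) * w.1 i + ∑ j, z j * w.2 j)
      map_zero' := by simp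
      map_add' := fun w w' => by
        simp only [Prod.fst_add, Prod.snd_add, Pi.add_apply, Int.cast_add, mul_add,
          Finset.sum_add_distrib]
        ring }
  have hℓ : ∀ w, ℓ w = -(∑ i, (x i + c) * w.1 i + ∑ j, z j * w.2 j) := fun w => rfl
  have hs : ∀ {n : ℕ} (f : Fin n → ℝ) (i : Fin n),
      ∑ k, f k * ((Pi.single i 1 : Fin n → ℤ) k : ℝ) = f i := by
    intro n f i
    simp [Pi.single_apply]
  refine isStabilizing_of_forall T ℓ (fun h0 => ?_) fun p q hpq => ?_
  · have h1 := DFunLike.congr_fun h0 (Pi.single ⟨0, ha⟩ 1, 0)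
    rw [hℓ, hs] at h1
    simp [c] at h1
  · have h1 := (hT q.1 q.2 p.1 p.2).mp hpq
    rw [hℓ]
    simp only [coeffWeight, Pi.sub_apply, Int.cast_sub, mul_sub, Finset.sum_sub_distrib, hs]
    linarith

/-- A nonzero weight vector of `End(A ⊗ B)^*` which vanishes on the tangent directions of
`Fl(A) × Fl(B)` yields a weight of the positive degree part of `S^*(gr(N^*))`. -/
theorem mem_weights_of_charSpace (hu : y.1.IsAdapted u) (hv : y.2.IsAdapted v)
    {w : WeightLattice a b} {Φ : Module.Dual ℂ (Module.End ℂ (A ⊗[ℂ] B))}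
    (hΦ : Φ ∈ Representation.charSpace (((T.iota A B).dualEndRep y).comp (levi hu hv))
      (weightHom w)) (h0 : Φ ≠ 0) (h1 : ∀ X ∈ ((T.iota A B).toFun y).stabEnd, Φ X = 0)
    (h2 : ∀ X, Φ (LinearMap.rTensorHom B X) = 0) (h3 : ∀ Y, Φ (LinearMap.lTensorHom A Y) = 0) :
    w ∈ weights ((T.iota A B).symGrConormalRep hu hv) (SymmetricAlgebra.positivePart _) := by
  obtain ⟨ξ, rfl⟩ := (T.iota A B).exists_dualMap_toNormal_eq y Φ h1 h2 h3
  have hξ : ξ ∈ Representation.charSpace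
      (((T.iota A B).conormalRep y).comp (levi hu hv)) (weightHom w) := fun t =>
    (T.iota A B).dualMap_toNormal_injective y ((hΦ t).trans (_root_.map_smul _ _ _).symm)
  exact mem_weights_of_mem_charSpace _ (unipotentRadical y) (levi hu hv)
    (filtration_conormalRep_eq_top T y) hξ fun h => h0 (by rw [h, map_zero])

/-- A matrix entry between boxes in different rows and different columns vanishes on every `X ⊗ 1`
and every `1 ⊗ Y`. -/
theorem coeffWeight_mem_weights (hu : y.1.IsAdapted u) (hv : y.2.IsAdapted v)
    {p q : Fin a × Fin b} (h : T.entry q < T.entry p) (h1 : q.1 ≠ p.1) (h2 : q.2 ≠ p.2) :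
    coeffWeight p q ∈
      weights ((T.iota A B).symGrConormalRep hu hv) (SymmetricAlgebra.positivePart _) := by
  refine mem_weights_of_charSpace T hu hv (coeff_mem_charSpace _ hu hv p q) (fun h0 => ?_)
    (fun X hX => coeff_eq_zero_of_mem_stabEnd T hu hv h hX)
    (fun X => by rw [coeff_rTensorHom, if_neg h2, mul_zero])
    (fun Y => by rw [coeff_lTensorHom, if_neg h1, zero_mul])
  have h3 := coeff_tensorUnit u v p q p q
  rw [h0] at h3
  simp at h3

/-- For boxes in a common row or column one coefficient alone need not vanish on the tangent
directions of `Fl(A) × Fl(B)`; the difference of two coefficients of the same weight that agree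
there does. -/
theorem coeffWeight_mem_weights_of_sub (hu : y.1.IsAdapted u) (hv : y.2.IsAdapted v)
    {p q p' q' : Fin a × Fin b} (h : T.entry q < T.entry p) (h' : T.entry q' < T.entry p')
    (hne : p ≠ p') (hw : coeffWeight p' q' = coeffWeight p q)
    (h2 : ∀ X, coeff u v p q (LinearMap.rTensorHom B X) =
      coeff u v p' q' (LinearMap.rTensorHom B X))
    (h3 : ∀ Y, coeff u v p q (LinearMap.lTensorHom A Y) =
      coeff u v p' q' (LinearMap.lTensorHom A Y)) :
    coeffWeight p q ∈
      weights ((T.iota A B).symGrConormalRep hu hv) (SymmetricAlgebra.positivePart _) := by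
  refine mem_weights_of_charSpace T hu hv (Φ := coeff u v p q - coeff u v p' q')
    (Submodule.sub_mem _ (coeff_mem_charSpace _ hu hv p q)
      (hw ▸ coeff_mem_charSpace _ hu hv p' q')) (fun h0 => ?_)
    (fun X hX => ?_) (fun X => by rw [LinearMap.sub_apply, h2, sub_self])
    (fun Y => by rw [LinearMap.sub_apply, h3, sub_self])
  · have h4 := LinearMap.congr_fun h0 (tensorUnit u v p q)
    rw [LinearMap.sub_apply, coeff_tensorUnit, coeff_tensorUnit] at h4
    simp [hne] at h4
  · rw [LinearMap.sub_apply, coeff_eq_zero_of_mem_stabEnd T hu hv h hX,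
      coeff_eq_zero_of_mem_stabEnd T hu hv h' hX, sub_zero]

theorem coeffWeight_mem_weights_of_row_lt (hb : 1 < b) (hu : y.1.IsAdapted u)
    (hv : y.2.IsAdapted v) {i k : Fin a} (hik : i < k) (j : Fin b) :
    coeffWeight (k, j) (i, j) ∈
      weights ((T.iota A B).symGrConormalRep hu hv) (SymmetricAlgebra.positivePart _) := by
  have : Nontrivial (Fin b) := Fin.nontrivial_iff_two_le.mpr hb
  obtain ⟨j', hj⟩ := exists_ne j
  -- In columns `j` and `j'`, `X ⊗ 1` has the same entry of `X`, while `1 ⊗ Y` has zero entries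
  -- because `i ≠ k`.
  refine coeffWeight_mem_weights_of_sub T hu hv (p' := (k, j')) (q' := (i, j'))
    (T.col_strict _ hik) (T.col_strict _ hik) (by simp [hj.symm]) (by simp [coeffWeight])
    (fun X => by simp only [coeff_rTensorHom, if_true])
    (fun Y => by simp only [coeff_lTensorHom, hik.ne, if_false, zero_mul])

theorem coeffWeight_mem_weights_of_col_lt (ha : 1 < a) (hu : y.1.IsAdapted u)
    (hv : y.2.IsAdapted v) (i : Fin a) {j l : Fin b} (hjl : j < l) :
    coeffWeight (i, l) (i, j) ∈
      weights ((T.iota A B).symGrConormalRep hu hv) (SymmetricAlgebra.positivePart _) := by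
  have : Nontrivial (Fin a) := Fin.nontrivial_iff_two_le.mpr ha
  obtain ⟨i', hi⟩ := exists_ne i
  refine coeffWeight_mem_weights_of_sub T hu hv (p' := (i', l)) (q' := (i', j))
    (T.row_strict _ hjl) (T.row_strict _ hjl) (by simp [hi.symm]) (by simp [coeffWeight])
    (fun X => by simp only [coeff_rTensorHom, hjl.ne, if_false, mul_zero])
    (fun Y => by simp only [coeff_lTensorHom, if_true])

theorem map_coeffWeight (ℓ : WeightLattice a b →+ ℝ) (p q : Fin a × Fin b) :
    ℓ (coeffWeight p q) = ℓ (Pi.single q.1 1, 0) + ℓ (0, Pi.single q.2 1) -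
      (ℓ (Pi.single p.1 1, 0) + ℓ (0, Pi.single p.2 1)) := by
  rw [← map_add, ← map_add, ← map_sub]
  congr 1
  simp [coeffWeight]

/-- The numbers are `x_i = -ℓ(e_i)` and `y_j = -ℓ(f_j)`. Positivity of `ℓ` on the weights with a
common column or row gives their monotonicity, and on the other weights the comparison of boxes. -/
theorem isAdditive_of_isStabilizing (ha : 1 < a) (hb : 1 < b) (u : Module.Basis (Fin a) ℂ A)
    (v : Module.Basis (Fin b) ℂ B) (h : (T.iota A B).IsStabilizing) : T.IsAdditive := by
  have hu : (CompleteFlag.ofBasis u).IsAdapted u := fun _ => rfl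
  have hv : (CompleteFlag.ofBasis v).IsAdapted v := fun _ => rfl
  obtain ⟨ℓ, -, hℓ⟩ := h (CompleteFlag.ofBasis u, CompleteFlag.ofBasis v) u v hu hv
  have hx : StrictMono fun i : Fin a => -ℓ (Pi.single i 1, 0) := fun i k hik => by
    have h1 := hℓ _ (coeffWeight_mem_weights_of_row_lt T hb hu hv hik ⟨0, by omega⟩)
    rw [map_coeffWeight] at h1
    dsimp only at h1 ⊢
    linarith
  have hz : StrictMono fun j : Fin b => -ℓ (0, Pi.single j 1) := fun j l hjl => by
    have h1 := hℓ _ (coeffWeight_mem_weights_of_col_lt T ha hu hv ⟨0, by omega⟩ hjl)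
    rw [map_coeffWeight] at h1
    dsimp only at h1 ⊢
    linarith
  have key : ∀ p q : Fin a × Fin b, T.entry q < T.entry p →
      -ℓ (Pi.single q.1 1, 0) + -ℓ (0, Pi.single q.2 1) <
        -ℓ (Pi.single p.1 1, 0) + -ℓ (0, Pi.single p.2 1) := by
    rintro ⟨k, l⟩ ⟨i, j⟩ hpq
    by_cases h1 : i = k
    · subst h1
      have h2 := hz ((T.row_strict i).lt_iff_lt.mp hpq)
      dsimp only at h2 ⊢
      linarith
    by_cases h2 : j = l
    · subst h2
      have h2 := hx ((T.col_strict j).lt_iff_lt.mp hpq)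
      dsimp only at h2 ⊢
      linarith
    have h3 := hℓ _ (coeffWeight_mem_weights T hu hv hpq h1 h2)
    rw [map_coeffWeight] at h3
    linarith
  refine ⟨_, _, hx, hz, fun i j k l => ⟨key (k, l) (i, j), fun hlt => ?_⟩⟩
  -- Since `T` orders the boxes totally, the implication `key` is automatically an equivalence.
  rcases lt_trichotomy (T.entry (i, j)) (T.entry (k, l)) with h1 | h1 | h1
  · exact h1
  · obtain ⟨rfl, rfl⟩ := Prod.mk.inj (T.entry.injective h1)
    exact absurd hlt (lt_irrefl _)
  · exact absurd hlt (key _ _ h1).le.not_gt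

end EquivariantFlagMap

namespace RectTableau

theorem isAdditive_of_one_row {b : ℕ} (T : RectTableau 1 b) : T.IsAdditive := by
  refine ⟨fun _ => 0, fun j => (j : ℕ), Subsingleton.strictMono _,
    fun j l h => Nat.cast_lt.mpr h, fun i j k l => ?_⟩
  obtain rfl := Subsingleton.elim i k
  rw [(T.row_strict i).lt_iff_lt]
  simp

theorem isAdditive_of_one_col {a : ℕ} (T : RectTableau a 1) : T.IsAdditive := by
  refine ⟨fun i => (i : ℕ), fun _ => 0, fun i k h => Nat.cast_lt.mpr h,
    Subsingleton.strictMono _, fun i j k l => ?_⟩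
  obtain rfl := Subsingleton.elim j l
  rw [(T.col_strict j).lt_iff_lt]
  simp

end RectTableau

end

/-- The equivariant embeddings `Fl(A) × Fl(B) ↪ Fl(A ⊗ B)` are exactly the `ι_T`, for a unique
standard tableau `T` of shape `a × b`, and `ι_T` is stabilizing if and only if `T` is additive. -/
theorem mainTheorem2 {A B : Type*} [AddCommGroup A] [Module ℂ A] [FiniteDimensional ℂ A]
    [AddCommGroup B] [Module ℂ B] [FiniteDimensional ℂ B] (a b : ℕ) (ha : 0 < a) (hb : 0 < b)
    (hA : Module.finrank ℂ A = a) (hB : Module.finrank ℂ B = b) :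
    (∀ T : RectTableau a b, (T.iota A B).IsEmbedding) ∧
    (∀ ι : EquivariantFlagMap a b A B, ι.IsEmbedding → ∃! T : RectTableau a b, ι = T.iota A B) ∧
    (∀ T : RectTableau a b, (T.iota A B).IsStabilizing ↔ T.IsAdditive) := by
  let u : Module.Basis (Fin a) ℂ A := Module.finBasisOfFinrankEq ℂ A hA
  let v : Module.Basis (Fin b) ℂ B := Module.finBasisOfFinrankEq ℂ B hB
  refine ⟨fun T => T.iota_isEmbedding ha hb, fun ι _ => ?_, fun T => ⟨fun h => ?_, fun h =>
    EquivariantFlagMap.isStabilizing_of_isAdditive T ha h⟩⟩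
  · obtain ⟨T, rfl⟩ := ι.exists_eq_iota (CompleteFlag.ofBasis u, CompleteFlag.ofBasis v)
    exact ⟨T, rfl, fun T' h => (RectTableau.iota_inj u v h).symm⟩
  -- With one row or one column there is no second row or column to form differences of
  -- coefficients, but such a tableau is additive in any case.
  · rcases Nat.eq_or_lt_of_le (Nat.succ_le_of_lt ha) with rfl | ha'
    · exact T.isAdditive_of_one_row
    rcases Nat.eq_or_lt_of_le (Nat.succ_le_of_lt hb) with rfl | hb'
    · exact T.isAdditive_of_one_col
    exact EquivariantFlagMap.isAdditive_of_isStabilizing T ha' hb' u v h
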